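/- **Model.** There are customer classes $1,\dots,I$ and server pools $1,\dots,J$, with arrival rates $\lambda_i>0$, pool sizes $\beta_j>0$ and service rates $\mu_{ij}\ge 0$ ($\mu_{ij}=0$ if pool $j$ cannot serve class $i$). The static planning problem is to minimize $\rho$ over $x_{ij}\ge0$ and $\rho$ subject to $\sum_j x_{ij}=\lambda_i$ for all $i$ and $\sum_i x_{ij}/(\beta_j\mu_{ij})\le\rho$ for all $j$ (with $x_{ij}=0$ if $\mu_{ij}=0$). Assume that it has a unique optimal solution, that the set $\mathcal E=\{(ij): x_{ij}>0\}$ of basic activities for this solution is a tree on the vertex set of all classes and pools, and that its optimal value satisfies $\rho<1$. Only activities in $\mathcal E$ are used, and all sums below run over $\mathcal E$. Assume further: if $\psi_{ij}\ge 0$, $(ij)\in\mathcal E$, satisfy $\sum_j\mu_{ij}\psi_{ij}=\lambda_i$ for all $i$ and $\sum_i\psi_{ij}\le\beta_j$ for all $j$, then $\psi_{ij}>0$ for all $(ij)\in\mathcal E$. **Priorities.** The classes are numbered in an order in which they disappear when the vertices of the tree are removed one by one, each being a leaf of what remains. The activities are given strict priorities, from the highest to the lowest, by removing them one by one: each time an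 activity $(ij)$ is removed where $i$ is the lowest-numbered class with remaining activities and either $(ij)$ is the only remaining activity of class $i$ or $(ij)$ is the only remaining activity of pool $j$. Pools are numbered so that the lowest-priority activity is $(IJ)$. Write $(ij)<(i'j')$ if $(ij)$ has higher priority. The equilibrium occupancies are $\psi^*_{ij}=\lambda_{ij}/\mu_{ij}$, where, recursively in the order of priority, $$\lambda_{ij}=\min\Bigl(\lambda_i-\sum_{(ij')<(ij)}\lambda_{ij'},\ \mu_{ij}\bigl(\beta_j-\sum_{(i'j)<(ij)}\lambda_{i'j}/\mu_{i'j}\bigr)\Bigr).$$ **Process.** In the system with parameter $r>0$, pool $j$ has $\lfloor\beta_j r\rfloor$ servers. Let $\Psi^r_{ij}(t)$ be the number of pool $j$ servers serving class $i$ and $Q^r_i(t)$ the number of waiting class $i$ customers. A realization is determined by an initial state, in which no pool exceeds its number of servers and $Q_i>0$ only if all pools $j$ with $(ij)\in\mathcal E$ are full, and by realizations $\Pi_i^{(a)},\Pi^{(s)}_{ij}$ of the driving unit-rate counting processes; arrivals and service completions are counted by $$A^r_i(t)=\Pi^{(a)}_i(\lambda_i r t),\qquad D^r_{ij}(t)=\Pi^{(s)}_{ij}\Bigl(\mu_{ij}\int_0^t\Psi^r_{ij}(u)\,du\Bigr),$$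 and these events occur one at a time. An arriving class $i$ customer goes to the pool $j$ with an idle server for which $(ij)\in\mathcal E$ has the highest priority, and waits in queue if there is no such pool; a pool $j$ server completing a service takes a customer from the nonempty queue of the lowest-numbered class $i$ with $(ij)\in\mathcal E$, and stays idle if there is none. Put $F^r(t)=\bigl((\Psi^r_{ij}(t)-r\psi^*_{ij})_{(ij)\in\mathcal E},(Q^r_i(t))_i\bigr)$. A *local fluid model* is a Lipschitz function $\tilde f=((\tilde\psi_{ij}),(\tilde q_i))$ on $[0,\infty)$ such that for all $t\ge0$: $\tilde q_i(t)=0$ for all $i$; $\sum_j\tilde\psi_{ij}(t)=\sum_j\tilde\psi_{ij}(0)-\sum_j\int_0^t\mu_{ij}\tilde\psi_{ij}(s)\,ds$ for all $i$; and $\sum_i\tilde\psi_{ij}(t)=0$ for all $j<J$. **Theorem.** (a) Fix $0<\epsilon<1/2$. Consider a sequence of parameters $r\to\infty$, positive numbers $h(r)$ with $r^{1/2+\epsilon}\le h(r)$ and $h(r)=o(r)$, and a sequence of (deterministic) realizations of the systems with parameters $r$, such that, uniformly on compact subsets of $[0,\infty)$ (u.o.c.), $$h(r)^{-1}\bigl(A^r_i(t)-\lambda_i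 rt\bigr)\to0\quad\forall i,\qquad h(r)^{-1}\Bigl(D^r_{ij}(t)-\mu_{ij}\int_0^t\Psi^r_{ij}(s)\,ds\Bigr)\to0\quad\forall (ij)\in\mathcal E .$$ Suppose that $h(r)^{-1}F^r(0)\to \tilde f(0)=((\tilde\psi_{ij}(0)),(\tilde q_i(0)))$, where $\tilde q_i(0)=0$ for all $i$ and $\sum_i\tilde\psi_{ij}(0)=0$ for all $j<J$. Then every subsequence of $r$ has a further subsequence along which $h(r)^{-1}F^r(\cdot)$ converges u.o.c. to a local fluid model $\tilde f(\cdot)$ with initial state $\tilde f(0)$. (b) Local fluid models depend continuously on the initial state: if $\tilde f^k$, $k\ge 1$, and $\tilde f$ are local fluid models and $\tilde f^k(0)\to\tilde f(0)$, then $\tilde f^k\to\tilde f$ u.o.c. (In particular, a local fluid model is determined by its initial state.) (c) There are constants $c_1,c_2>0$, depending only on the network, such that $|\tilde f(t)|\le c_1e^{-c_2t}|\tilde f(0)|$ for all $t\ge0$ and every local fluid model $\tilde f$, where $|\cdot|$ is the Euclidean norm. -/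

import Mathlib

open Filter Topology Set
open scoped BigOperators

/-- The primitive data of the model: customer classes are `Fin (m + 1)` (so `I = m + 1`), server
pools are `Fin (n + 1)` (so `J = n + 1`); `lam i` is the arrival rate of class `i`, `beta j` the
size of pool `j` (both per unit of the scaling parameter), and `mu i j` is the rate at which a
pool `j` server serves a class `i` customer (`0` if it cannot serve this class). -/
structure Params (m n : ℕ) where
  lam : Fin (m + 1) → ℝ
  beta : Fin (n + 1) → ℝ
  mu : Fin (m + 1) → Fin (n + 1) → ℝ
  lam_pos : ∀ i, 0 < lam i
  beta_pos : ∀ j, 0 < beta j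
  mu_nonneg : ∀ i j, 0 ≤ mu i j

/-- Feasible points `(x, ρ)` of the static planning problem.  No flow may use a pair `(i, j)` with
`mu i j = 0`, so the quotients below are never divisions of a nonzero number by zero. -/
structure Params.SPPFeasible {m n : ℕ} (N : Params m n)
    (x : Fin (m + 1) → Fin (n + 1) → ℝ) (ρ : ℝ) : Prop where
  nonneg : ∀ i j, 0 ≤ x i j
  support : ∀ i j, N.mu i j = 0 → x i j = 0
  flow : ∀ i, ∑ j, x i j = N.lam i
  load : ∀ j, ∑ i, x i j / (N.beta j * N.mu i j) ≤ ρ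

/-- Optimal solutions of the static planning problem: minimise `ρ`. -/
def Params.SPPOptimal {m n : ℕ} (N : Params m n)
    (x : Fin (m + 1) → Fin (n + 1) → ℝ) (ρ : ℝ) : Prop :=
  N.SPPFeasible x ρ ∧ ∀ x' ρ', N.SPPFeasible x' ρ' → ρ ≤ ρ'

/-- The bipartite graph on classes and pools with an edge `i — j` whenever `0 < x i j`. -/
def activityGraph {m n : ℕ} (x : Fin (m + 1) → Fin (n + 1) → ℝ) :
    SimpleGraph (Fin (m + 1) ⊕ Fin (n + 1)) :=
  SimpleGraph.fromRel fun v w => ∃ i j, v = Sum.inl i ∧ w = Sum.inr j ∧ 0 < x i j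

/-- A network satisfying complete resource pooling (the static planning problem has a unique
optimal solution, whose support is a tree) and the underload condition `ρ < 1`. -/
structure Network (m n : ℕ) extends Params m n where
  spp : Fin (m + 1) → Fin (n + 1) → ℝ
  rho : ℝ
  spp_optimal : toParams.SPPOptimal spp rho
  spp_unique : ∀ x' ρ', toParams.SPPOptimal x' ρ' → x' = spp ∧ ρ' = rho
  tree : (activityGraph spp).IsTree
  rho_lt_one : rho < 1

namespace Network

variable {m n : ℕ} (N : Network m n)

/-- The basic activities `(i, j)`. -/
abbrev Edge : Type := {e : Fin (m + 1) × Fin (n + 1) // 0 < N.spp e.1 e.2}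

/-- The sum over the activities of class `i`. -/
noncomputable def classSum {M : Type*} [AddCommMonoid M] (f : N.Edge → M) (i : Fin (m + 1)) : M :=
  ∑ e : N.Edge with e.1.1 = i, f e

/-- The sum over the activities of pool `j`. -/
noncomputable def poolSum {M : Type*} [AddCommMonoid M] (f : N.Edge → M) (j : Fin (n + 1)) : M :=
  ∑ e : N.Edge with e.1.2 = j, f e

/-- The service rate of an activity. -/
def muE (e : N.Edge) : ℝ := N.mu e.1.1 e.1.2

/-- Every activity must be used in order to handle the load. -/
def AllActivitiesEssential : Prop :=
  ∀ psi : N.Edge → ℝ, (∀ e, 0 ≤ psi e) →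
    (∀ i, N.lam i = N.classSum (fun e => N.muE e * psi e) i) →
    (∀ j, N.poolSum psi j ≤ N.beta j) →
    ∀ e, 0 < psi e

/-- A leaf-activity priority assignment; a smaller number is a higher priority.

`class_order`: the customer classes are numbered in the order in which they disappear when the
vertices of the activity tree are removed one at a time, each being a leaf of what remains.

`smallest_class`, `leaf_edge`: the activities are removed one at a time; the activity being removed
belongs to the highest-priority class that still has activities, and either it is the only
remaining activity of its class, or it is the only remaining activity of its pool.

`lowest`: the activity of lowest priority is `(I, J)`. -/
structure Priority where
  prio : N.Edge → ℕ
  injective : Function.Injective prio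
  class_order : ∃ rank : Fin (m + 1) ⊕ Fin (n + 1) → ℕ, Function.Injective rank ∧
    (∀ v w w', (activityGraph N.spp).Adj v w → (activityGraph N.spp).Adj v w' →
      rank v < rank w → rank v < rank w' → w = w') ∧
    ∀ i i', i < i' → rank (Sum.inl i) < rank (Sum.inl i')
  smallest_class : ∀ e e', prio e ≤ prio e' → e.1.1 ≤ e'.1.1
  leaf_edge : ∀ e, (∀ e', prio e ≤ prio e' → e'.1.1 = e.1.1 → e' = e) ∨
    (∀ e', prio e ≤ prio e' → e'.1.2 = e.1.2 → e' = e)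
  lowest : ∃ e : N.Edge, e.1 = (Fin.last m, Fin.last n) ∧ ∀ e', prio e' ≤ prio e

variable {N}

/-- The equilibrium routing rates: going through the activities in the order of priority, each
takes the remaining arrival rate of its class or the remaining service capacity of its pool,
whichever is smaller. -/
noncomputable def Priority.eqRate (P : N.Priority) (e : N.Edge) : ℝ :=
  min
    (N.lam e.1.1 - ∑ e' : {e' : N.Edge // e'.1.1 = e.1.1 ∧ P.prio e' < P.prio e},
      P.eqRate e'.1)
    (N.muE e * (N.beta e.1.2 -
      ∑ e' : {e' : N.Edge // e'.1.2 = e.1.2 ∧ P.prio e' < P.prio e},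
        P.eqRate e'.1 / N.muE e'.1))
termination_by P.prio e
decreasing_by
  · exact e'.2.2
  · exact e'.2.2

/-- The equilibrium occupancies. -/
noncomputable def Priority.psiStar (P : N.Priority) (e : N.Edge) : ℝ := P.eqRate e / N.muE e

variable (N)

/-- The state of a system: `psi e` is the number of servers of pool `e.1.2` serving customers of
class `e.1.1`, and `q i` is the number of class `i` customers waiting. -/
@[ext]
structure State where
  psi : N.Edge → ℕ
  q : Fin (m + 1) → ℕ

/-- The number of servers of pool `j` in the system with parameter `r`. -/
noncomputable def servers (r : ℝ) (j : Fin (n + 1)) : ℕ := ⌊N.beta j * r⌋₊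

variable {N}

/-- States that can occur in the system with parameter `r`: no pool has more busy servers than
servers, and a class has waiting customers only if all pools that can serve it are full. -/
def State.Admissible (s : N.State) (r : ℝ) : Prop :=
  (∀ j, N.poolSum s.psi j ≤ N.servers r j) ∧
    ∀ e : N.Edge, 0 < s.q e.1.1 → N.poolSum s.psi e.1.2 = N.servers r e.1.2

/-- Pool `j` has an unoccupied server. -/
def State.HasIdle (s : N.State) (r : ℝ) (j : Fin (n + 1)) : Prop :=
  N.poolSum s.psi j < N.servers r j

/-- Routing: a class `i` arrival takes state `s` to state `s'`.  The customer enters the pool with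
idle servers whose activity has the highest priority, or the queue if there is no such pool. -/
def Priority.ArrivalStep (P : N.Priority) (r : ℝ) (i : Fin (m + 1)) (s s' : N.State) : Prop :=
  (∃ e : N.Edge, e.1.1 = i ∧ s.HasIdle r e.1.2 ∧
    (∀ e' : N.Edge, e'.1.1 = i → s.HasIdle r e'.1.2 → P.prio e ≤ P.prio e') ∧
    s'.psi = s.psi + Pi.single e 1 ∧ s'.q = s.q) ∨
  ((∀ e : N.Edge, e.1.1 = i → ¬ s.HasIdle r e.1.2) ∧
    s'.psi = s.psi ∧ s'.q = s.q + Pi.single i 1)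

/-- Scheduling: a service completion of activity `e` takes state `s` to state `s'`.  The server
takes a customer of the highest-priority nonempty queue that its pool can serve, and stays idle if
there is none. -/
def DepartureStep (e : N.Edge) (s s' : N.State) : Prop :=
  0 < s.psi e ∧
  ((∃ e' : N.Edge, e'.1.2 = e.1.2 ∧ 0 < s.q e'.1.1 ∧
    (∀ e'' : N.Edge, e''.1.2 = e.1.2 → 0 < s.q e''.1.1 → e'.1.1 ≤ e''.1.1) ∧
    s'.psi + Pi.single e 1 = s.psi + Pi.single e' 1 ∧ s'.q + Pi.single e'.1.1 1 = s.q) ∨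
  ((∀ e' : N.Edge, e'.1.2 = e.1.2 → s.q e'.1.1 = 0) ∧
    s'.psi + Pi.single e 1 = s.psi ∧ s'.q = s.q))

/-- A realization of a simple counting process on `[0, ∞)`: it starts at `0`, is right-continuous
and piecewise constant, and has jumps of size one. -/
structure IsCountingPath (p : ℝ → ℕ) : Prop where
  zero : p 0 = 0
  right : ∀ t, 0 ≤ t → ∀ᶠ u in 𝓝[>] t, p u = p t
  left : ∀ t, 0 < t → ∃ k, (∀ᶠ u in 𝓝[<] t, p u = k) ∧ (p t = k ∨ p t = k + 1)

/-- The arrivals of class `i` in `[0, t]` generated by the driving path `PiA i`. -/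
noncomputable def arrivals (N : Network m n) (r : ℝ) (PiA : Fin (m + 1) → ℝ → ℕ) (t : ℝ)
    (i : Fin (m + 1)) : ℕ :=
  PiA i (N.lam i * r * t)

/-- The service completions of activity `e` in `[0, t]` generated by the driving path `PiS e`. -/
noncomputable def departures (PiS : N.Edge → ℝ → ℕ) (state : ℝ → N.State) (t : ℝ)
    (e : N.Edge) : ℕ :=
  PiS e (N.muE e * ∫ u in (0 : ℝ)..t, ((state u).psi e : ℝ))

/-- A realization of the system with parameter `r` under the leaf activity priority policy, on the
time interval `[0, ∞)`.  It is generated by realizations `PiA`, `PiS` of the driving unit-rate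
processes; at most one event (an arrival or a service completion) occurs at a time, the state
changes only at events, and it changes according to the policy. -/
structure Realization (P : N.Priority) (r : ℝ) where
  PiA : Fin (m + 1) → ℝ → ℕ
  PiS : N.Edge → ℝ → ℕ
  countingA : ∀ i, IsCountingPath (PiA i)
  countingS : ∀ e, IsCountingPath (PiS e)
  state : ℝ → N.State
  initial : (state 0).Admissible r
  right : ∀ t, 0 ≤ t → ∀ᶠ u in 𝓝[>] t, state u = state t
  event : ∀ t, 0 < t → ∃ (s : N.State) (a : Fin (m + 1) → ℕ) (d : N.Edge → ℕ),
    (∀ᶠ u in 𝓝[<] t, state u = s ∧ arrivals N r PiA u = a ∧ departures PiS state u = d) ∧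
    ((arrivals N r PiA t = a ∧ departures PiS state t = d ∧ state t = s) ∨
     (∃ i, arrivals N r PiA t = a + Pi.single i 1 ∧ departures PiS state t = d ∧
        P.ArrivalStep r i s (state t)) ∨
     (∃ e, arrivals N r PiA t = a ∧ departures PiS state t = d + Pi.single e 1 ∧
        DepartureStep e s (state t)))

namespace Realization

variable {P : N.Priority} {r : ℝ} (R : Realization P r)

/-- `A_i(t)`. -/
noncomputable def A (i : Fin (m + 1)) (t : ℝ) : ℕ := arrivals N r R.PiA t i

/-- `D_ij(t)`. -/
noncomputable def D (e : N.Edge) (t : ℝ) : ℕ := departures R.PiS R.state t e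

end Realization

variable (N)

/-- Vectors `((ψ_ij), (q_i))` with the Euclidean norm. -/
abbrev Vec : Type := EuclideanSpace ℝ (N.Edge ⊕ Fin (m + 1))

variable {N}

/-- The `(ψ_ij)` part of a vector. -/
def psiPart (f : N.Vec) (e : N.Edge) : ℝ := f (Sum.inl e)

/-- The `(q_i)` part of a vector. -/
def qPart (f : N.Vec) (i : Fin (m + 1)) : ℝ := f (Sum.inr i)

/-- The unscaled deviation from the equilibrium, `F(t) = (Ψ_ij(t) - r ψ*_ij, Q_i(t))`. -/
noncomputable def Realization.deviation {P : N.Priority} {r : ℝ} (R : Realization P r) (t : ℝ) :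
    N.Vec :=
  WithLp.toLp 2 (Sum.elim (fun e => ((R.state t).psi e : ℝ) - r * P.psiStar e)
    (fun i => ((R.state t).q i : ℝ)))

/-- Local fluid models: Lipschitz functions on `[0, ∞)` with zero queues, full pools `j < J`, and
the linear dynamics of the class totals. -/
structure IsLocalFluidModel (N : Network m n) (f : ℝ → N.Vec) : Prop where
  lipschitz : ∃ K, LipschitzOnWith K f (Ici 0)
  queues : ∀ t, 0 ≤ t → ∀ i, qPart (f t) i = 0
  dynamics : ∀ t, 0 ≤ t → ∀ i, N.classSum (psiPart (f t)) i =
    N.classSum (psiPart (f 0)) i -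
      N.classSum (fun e => ∫ s in (0 : ℝ)..t, N.muE e * psiPart (f s) e) i
  pools : ∀ t, 0 ≤ t → ∀ j, j < Fin.last n → N.poolSum (psiPart (f t)) j = 0

end Network

/-- Convergence, uniform on compact subsets of `[0, ∞)`. -/
def UOC {E : Type*} [UniformSpace E] (F : ℕ → ℝ → E) (f : ℝ → E) : Prop :=
  ∀ T : ℝ, TendstoUniformlyOn F f atTop (Icc 0 T)

namespace Network

variable {m n : ℕ} {N : Network m n}

/-! A leaf order makes the network triangular. An activity is either the last one of its class or
the lowest-priority one of its pool, and in the second case the pool is not `J`. A tree on I + J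
vertices has I + J - 1 edges, so this pairs the activities with the classes and the pools j < J
(`vertex_bijective`). Hence a vector indexed by activities is determined by its class sums, with any
nonzero weights, and its pool sums for j < J: each component is read off from those of higher
priority (`sums_bijective`).

Equilibrium: the balanced solution with all pools j < J full exists by triangularity. Optimality in
the planning problem leaves pool J slack, essentiality of the activities makes all components
positive, and the priority recursion reproduces this solution (`psiStar_spec`).

Fluid models: the total of a class obeys a scalar equation with decay rate `muE` of its last
activity and forcing from higher priorities; every other activity is minus the rest of its pool.
Components therefore decay exponentially one after another (`exists_decay`). The model is a linear
differential equation, so solutions exist, and the difference of two solutions is again one: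
continuous dependence and decay come from the same estimate.

Prelimit: queues, and idle servers of pools j < J, must stay of the order of the driving errors
(`exists_collapse_edge`). This is again an induction on priority. For an activity e, the classes and
pools upstream of e form a subsystem which exchanges no customers with the rest while the pool of e
has an idle server (e not last), or the class of e has a queue (e last). At equilibrium one activity
of positive rate joins the subsystem to its complement, so arrivals and departures differ by a drift
of order r that ends the excursion; only driving errors and higher-priority quantities can feed it.

After collapse, the distance to the fluid model with the limiting initial state satisfies a
perturbed integral inequality, and Grönwall's inequality applies (`exists_tracking`). Collapse
presupposes occupancies within a small multiple of r of equilibrium, and tracking gives this because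
h = o(r); an induction over continuous time closes the circle. The full sequence then converges. -/

theorem edge_ext {e e' : N.Edge} (h₁ : e.1.1 = e'.1.1) (h₂ : e.1.2 = e'.1.2) : e = e' :=
  Subtype.ext (Prod.ext h₁ h₂)

theorem muE_pos (e : N.Edge) : 0 < N.muE e := by
  refine lt_of_le_of_ne (N.mu_nonneg _ _) fun h => ?_
  exact e.2.ne' (N.spp_optimal.1.support _ _ h.symm)

/-- A tree has one edge fewer than its `m + 1 + (n + 1)` vertices, and each edge of the bipartite
graph comes from exactly one activity. -/
theorem card_edge (N : Network m n) : Fintype.card N.Edge = m + 1 + n := by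
  classical
  have key := N.tree.card_edgeFinset
  rw [SimpleGraph.edgeFinset_card] at key
  let φ : N.Edge → (activityGraph N.spp).edgeSet := fun e =>
    ⟨s(Sum.inl e.1.1, Sum.inr e.1.2), by
      rw [SimpleGraph.mem_edgeSet, activityGraph, SimpleGraph.fromRel_adj]
      exact ⟨by simp, Or.inl ⟨_, _, rfl, rfl, e.2⟩⟩⟩
  have hφ : Function.Bijective φ := by
    constructor
    · intro e e' h
      have h' := congrArg Subtype.val h
      simp only [φ, Sym2.eq_iff] at h'
      rcases h' with h' | h'
      · exact edge_ext (Sum.inl_injective h'.1) (Sum.inr_injective h'.2)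
      · simp at h'
    · rintro ⟨x, hx⟩
      induction x using Sym2.ind with
      | _ a b =>
        rw [SimpleGraph.mem_edgeSet, activityGraph, SimpleGraph.fromRel_adj] at hx
        rcases hx.2 with ⟨i, j, rfl, rfl, h⟩ | ⟨i, j, rfl, rfl, h⟩
        · exact ⟨⟨(i, j), h⟩, rfl⟩
        · exact ⟨⟨(i, j), h⟩, Subtype.ext Sym2.eq_swap⟩
  rw [← Fintype.card_of_bijective hφ] at key
  simp only [Fintype.card_sum, Fintype.card_fin] at key
  omega

/-! ### Leaf priorities: each activity is paired with a class or a pool. -/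

namespace Priority

variable (P : N.Priority)

/-- The activity has the lowest priority among the activities of its class. -/
def IsLast (e : N.Edge) : Prop := ∀ e', e'.1.1 = e.1.1 → P.prio e' ≤ P.prio e

variable {P}

theorem IsLast.eq {e e' : N.Edge} (h : P.IsLast e) (h' : P.IsLast e') (hc : e.1.1 = e'.1.1) :
    e = e' :=
  P.injective (le_antisymm (h' e hc) (h e' hc.symm))

/-- By `leaf_edge` an activity is, when removed, the only one left of its class or of its pool. The
first alternative would make it last of its class, so the second holds. -/
theorem prio_le_of_not_isLast {e : N.Edge} (h : ¬ P.IsLast e) (e' : N.Edge)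
    (hp : e'.1.2 = e.1.2) : P.prio e' ≤ P.prio e := by
  rcases P.leaf_edge e with h' | h'
  · refine absurd (fun e'' hc => ?_) h
    by_contra hlt
    rw [h' e'' (not_le.1 hlt).le hc] at hlt
    exact hlt le_rfl
  · by_contra hlt
    rw [h' e' (not_le.1 hlt).le hp] at hlt
    exact hlt le_rfl

theorem class_le_of_not_isLast {e : N.Edge} (h : ¬ P.IsLast e) (e' : N.Edge)
    (hp : e'.1.2 = e.1.2) : e'.1.1 ≤ e.1.1 :=
  P.smallest_class _ _ (prio_le_of_not_isLast h e' hp)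

theorem eq_of_not_isLast {e e' : N.Edge} (h : ¬ P.IsLast e) (h' : ¬ P.IsLast e')
    (hp : e.1.2 = e'.1.2) : e = e' :=
  P.injective (le_antisymm (prio_le_of_not_isLast h' e hp) (prio_le_of_not_isLast h e' hp.symm))

theorem prio_lt_of_class_lt {e e' : N.Edge} (h : e.1.1 < e'.1.1) : P.prio e < P.prio e' := by
  by_contra hle
  exact absurd (P.smallest_class _ _ (not_lt.1 hle)) (not_le.2 h)

theorem prio_lt_of_not_isLast {e e' : N.Edge} (h : ¬ P.IsLast e) (hp : e'.1.2 = e.1.2)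
    (hne : e' ≠ e) : P.prio e' < P.prio e :=
  lt_of_le_of_ne (prio_le_of_not_isLast h e' hp) fun h => hne (P.injective h)

theorem IsLast.prio_lt {e e' : N.Edge} (h : P.IsLast e) (hc : e'.1.1 = e.1.1)
    (hne : e' ≠ e) : P.prio e' < P.prio e :=
  lt_of_le_of_ne (h e' hc) fun h => hne (P.injective h)

/-- The lowest activity of all lies in pool J and is last of its class. A non-last activity of pool
J would be lowest in that pool and so coincide with it. -/
theorem pool_ne_last_of_not_isLast {e : N.Edge} (h : ¬ P.IsLast e) : e.1.2 ≠ Fin.last n := by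
  obtain ⟨l, hl, hmax⟩ := P.lowest
  intro hp
  have hle := prio_le_of_not_isLast h l (by rw [hl, hp])
  exact h (P.injective (le_antisymm (hmax e) hle) ▸ fun e' _ => hmax e')

variable (P)

open Classical in
/-- The vertex whose removal is forced by an activity: its class, if the activity is the last one
of the class, and otherwise its pool. -/
noncomputable def vertex (e : N.Edge) : Fin (m + 1) ⊕ {j : Fin (n + 1) // j ≠ Fin.last n} :=
  if h : P.IsLast e then Sum.inl e.1.1 else Sum.inr ⟨e.1.2, pool_ne_last_of_not_isLast h⟩

/-- Injectivity is immediate from the two kinds of activities, and the edge count of a tree upgrades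
it. Surjectivity is what gets used: every class has a last activity, and every pool j < J contains
an activity that is not last of its class. -/
theorem vertex_bijective : Function.Bijective P.vertex := by
  classical
  rw [Fintype.bijective_iff_injective_and_card]
  constructor
  · intro e e' h
    unfold vertex at h
    split_ifs at h with h₁ h₂ h₂
    · exact h₁.eq h₂ (Sum.inl_injective h)
    · exact eq_of_not_isLast h₁ h₂ (congrArg Subtype.val (Sum.inr_injective h))
  · rw [card_edge, Fintype.card_sum, Fintype.card_fin, Fintype.card_subtype_compl,
      Fintype.card_fin, Fintype.card_unique]
    omega

theorem exists_isLast (i : Fin (m + 1)) : ∃ e : N.Edge, P.IsLast e ∧ e.1.1 = i := by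
  obtain ⟨e, he⟩ := P.vertex_bijective.2 (Sum.inl i)
  unfold vertex at he
  split_ifs at he with h
  exact ⟨e, h, Sum.inl_injective he⟩

theorem exists_not_isLast {j : Fin (n + 1)} (hj : j ≠ Fin.last n) :
    ∃ e : N.Edge, ¬ P.IsLast e ∧ e.1.2 = j := by
  obtain ⟨e, he⟩ := P.vertex_bijective.2 (Sum.inr ⟨j, hj⟩)
  unfold vertex at he
  split_ifs at he with h
  exact ⟨e, h, congrArg Subtype.val (Sum.inr_injective he)⟩

/-- Induction over the activities in the order of priority. -/
theorem induction {motive : N.Edge → Prop}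
    (step : ∀ e, (∀ e', P.prio e' < P.prio e → motive e') → motive e) (e : N.Edge) : motive e :=
  (measure P.prio).wf.induction e step

end Priority

/-! ### Triangular systems of class and pool sums. -/

theorem classSum_eq_add (f : N.Edge → ℝ) (e : N.Edge) :
    N.classSum f e.1.1 = f e + ∑ e' : N.Edge with e'.1.1 = e.1.1 ∧ e' ≠ e, f e' := by
  rw [classSum, ← Finset.add_sum_erase _ _ (show e ∈ _ by simp)]
  congr 1
  refine Finset.sum_congr ?_ fun _ _ => rfl
  ext; simp [and_comm]

theorem poolSum_eq_add (f : N.Edge → ℝ) (e : N.Edge) :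
    N.poolSum f e.1.2 = f e + ∑ e' : N.Edge with e'.1.2 = e.1.2 ∧ e' ≠ e, f e' := by
  rw [poolSum, ← Finset.add_sum_erase _ _ (show e ∈ _ by simp)]
  congr 1
  refine Finset.sum_congr ?_ fun _ _ => rfl
  ext; simp [and_comm]

/-- Weighted class sums together with the pool sums of all pools but the last one. -/
noncomputable def sums (w : N.Edge → ℝ) :
    (N.Edge → ℝ) →ₗ[ℝ] (Fin (m + 1) → ℝ) × ({j : Fin (n + 1) // j ≠ Fin.last n} → ℝ) where
  toFun ψ := (fun i => N.classSum (fun e => w e * ψ e) i, fun j => N.poolSum ψ j.1)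
  map_add' ψ ψ' := by
    ext <;> simp [classSum, poolSum, mul_add, Finset.sum_add_distrib]
  map_smul' c ψ := by
    ext <;> simp [classSum, poolSum, Finset.mul_sum, mul_left_comm]

/-- A kernel vector vanishes in the order of priority: the class equation (last activity) or the
pool equation (any other) contains, besides the component itself, only components of higher
priority. -/
theorem sums_injective (P : N.Priority) {w : N.Edge → ℝ} (hw : ∀ e, w e ≠ 0) :
    Function.Injective (sums w) := by
  rw [← LinearMap.ker_eq_bot, LinearMap.ker_eq_bot']
  intro ψ h
  have h₁ : ∀ i, N.classSum (fun e => w e * ψ e) i = 0 := fun i =>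
    congrFun (congrArg Prod.fst h) i
  have h₂ : ∀ j, j ≠ Fin.last n → N.poolSum ψ j = 0 := fun j hj =>
    congrFun (congrArg Prod.snd h) ⟨j, hj⟩
  funext e
  induction e using P.induction with
  | step e ih =>
    by_cases he : P.IsLast e
    · have := classSum_eq_add (fun e => w e * ψ e) e
      rw [h₁, Finset.sum_eq_zero] at this
      · simpa [hw e] using this.symm
      · intro e' he'
        rw [Finset.mem_filter] at he'
        simp [ih e' (he.prio_lt he'.2.1 he'.2.2)]
    · have := poolSum_eq_add ψ e
      rw [h₂ _ (Priority.pool_ne_last_of_not_isLast he), Finset.sum_eq_zero] at this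
      · simpa using this.symm
      · intro e' he'
        rw [Finset.mem_filter] at he'
        simp [ih e' (Priority.prio_lt_of_not_isLast he he'.2.1 he'.2.2)]

theorem sums_bijective (P : N.Priority) {w : N.Edge → ℝ} (hw : ∀ e, w e ≠ 0) :
    Function.Bijective (sums w) := by
  refine ⟨sums_injective P hw,
    (LinearMap.injective_iff_surjective_of_finrank_eq_finrank ?_).1 (sums_injective P hw)⟩
  rw [Module.finrank_prod, Module.finrank_fintype_fun_eq_card, Module.finrank_fintype_fun_eq_card,
    Module.finrank_fintype_fun_eq_card, card_edge, Fintype.card_fin, Fintype.card_subtype_compl,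
    Fintype.card_fin, Fintype.card_unique]
  rfl

end Network

/-! ### The static planning problem and the equilibrium occupancies. -/

namespace Network

variable {m n : ℕ} {N : Network m n}

theorem classSum_eq_sum_pools (G : Fin (m + 1) → Fin (n + 1) → ℝ)
    (hG : ∀ i j, ¬ 0 < N.spp i j → G i j = 0) (i : Fin (m + 1)) :
    N.classSum (fun e => G e.1.1 e.1.2) i = ∑ j, G i j := by
  rw [classSum, ← Finset.sum_filter_of_ne (p := fun j => 0 < N.spp i j)
    fun j _ h => by_contra fun h' => h (hG i j h')]
  refine Finset.sum_bij (fun e _ => e.1.2) ?_ ?_ ?_ ?_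
  · intro e he
    rw [Finset.mem_filter] at he
    simpa [← he.2] using e.2
  · intro e he e' he' h
    rw [Finset.mem_filter] at he he'
    exact edge_ext (he.2.trans he'.2.symm) h
  · intro j hj
    rw [Finset.mem_filter] at hj
    exact ⟨⟨(i, j), hj.2⟩, by simp, rfl⟩
  · intro e he
    rw [Finset.mem_filter] at he
    rw [he.2]

theorem poolSum_eq_sum_classes (G : Fin (m + 1) → Fin (n + 1) → ℝ)
    (hG : ∀ i j, ¬ 0 < N.spp i j → G i j = 0) (j : Fin (n + 1)) :
    N.poolSum (fun e => G e.1.1 e.1.2) j = ∑ i, G i j := by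
  rw [poolSum, ← Finset.sum_filter_of_ne (p := fun i => 0 < N.spp i j)
    fun i _ h => by_contra fun h' => h (hG i j h')]
  refine Finset.sum_bij (fun e _ => e.1.1) ?_ ?_ ?_ ?_
  · intro e he
    rw [Finset.mem_filter] at he
    simpa [← he.2] using e.2
  · intro e he e' he' h
    rw [Finset.mem_filter] at he he'
    exact edge_ext h (he.2.trans he'.2.symm)
  · intro i hi
    rw [Finset.mem_filter] at hi
    exact ⟨⟨(i, j), hi.2⟩, by simp, rfl⟩
  · intro e he
    rw [Finset.mem_filter] at he
    rw [he.2]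

theorem spp_eq_zero {i : Fin (m + 1)} {j : Fin (n + 1)} (h : ¬ 0 < N.spp i j) : N.spp i j = 0 :=
  le_antisymm (not_lt.1 h) (N.spp_optimal.1.nonneg i j)

/-- The load of the pools cannot be lowered simultaneously. -/
theorem exists_poolSum_nonpos (d : N.Edge → ℝ)
    (hd : ∀ i, N.classSum (fun e => N.muE e * d e) i = 0) : ∃ j, N.poolSum d j ≤ 0 := by
  -- If all pool sums of `d` were positive, subtracting a small multiple `s` of the flow `N.muE e *
  -- d e` would keep the optimal point feasible and lower every load by more than `s * c`, against
  -- optimality.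
  by_contra! hpos
  have h₁ : ∀ᶠ s : ℝ in 𝓝[>] 0, ∀ e : N.Edge, s * (N.muE e * d e) < N.spp e.1.1 e.1.2 := by
    rw [eventually_all]
    intro e
    have : Tendsto (fun s : ℝ => s * (N.muE e * d e)) (𝓝[>] 0) (𝓝 0) := by
      have : Continuous fun s : ℝ => s * (N.muE e * d e) := by fun_prop
      simpa using (this.tendsto 0).mono_left nhdsWithin_le_nhds
    exact this.eventually_lt_const e.2
  have h₂ : ∀ᶠ c : ℝ in 𝓝[>] 0, ∀ j, c < N.poolSum d j / N.beta j := by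
    rw [eventually_all]
    intro j
    exact (tendsto_id.mono_left nhdsWithin_le_nhds).eventually_lt_const
      (div_pos (hpos j) (N.beta_pos j))
  obtain ⟨s, hs, hs0⟩ := (h₁.and self_mem_nhdsWithin).exists
  obtain ⟨c, hc, hc0⟩ := (h₂.and self_mem_nhdsWithin).exists
  replace hs0 : 0 < s := hs0
  replace hc0 : 0 < c := hc0
  let y : Fin (m + 1) → Fin (n + 1) → ℝ := fun i j =>
    if h : 0 < N.spp i j then N.muE ⟨(i, j), h⟩ * d ⟨(i, j), h⟩ else 0
  have hy : ∀ e : N.Edge, y e.1.1 e.1.2 = N.muE e * d e := fun e => dif_pos e.2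
  have hy0 : ∀ i j, ¬ 0 < N.spp i j → y i j = 0 := fun i j h => dif_neg h
  have hfeas : N.SPPFeasible (fun i j => N.spp i j - s * y i j) (N.rho - s * c) := by
    constructor
    · intro i j
      by_cases h : 0 < N.spp i j
      · have := hs ⟨(i, j), h⟩
        rw [← hy] at this
        exact sub_nonneg.2 this.le
      · simp [hy0 i j h, spp_eq_zero h]
    · intro i j h
      have : N.spp i j = 0 := N.spp_optimal.1.support i j h
      simp [hy0 i j (by simp [this]), this]
    · intro i
      rw [Finset.sum_sub_distrib, ← Finset.mul_sum, ← classSum_eq_sum_pools y hy0]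
      simp only [hy]
      rw [hd, N.spp_optimal.1.flow]
      ring
    · intro j
      have h := N.spp_optimal.1.load j
      have : ∑ i, (N.spp i j - s * y i j) / (N.beta j * N.mu i j) =
          ∑ i, N.spp i j / (N.beta j * N.mu i j) -
            s * (∑ i, y i j / (N.beta j * N.mu i j)) := by
        rw [Finset.mul_sum, ← Finset.sum_sub_distrib]
        exact Finset.sum_congr rfl fun i _ => by ring
      rw [this, ← poolSum_eq_sum_classes (fun i j => y i j / (N.beta j * N.mu i j))
        (fun i j h => by simp [hy0 i j h])]
      have : N.poolSum (fun e => y e.1.1 e.1.2 / (N.beta e.1.2 * N.mu e.1.1 e.1.2)) j =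
          N.poolSum d j / N.beta j := by
        rw [poolSum, poolSum, Finset.sum_div]
        refine Finset.sum_congr rfl fun e he => ?_
        rw [Finset.mem_filter] at he
        have h₁ := muE_pos e
        have h₂ := N.beta_pos j
        rw [hy, he.2, show N.mu e.1.1 j = N.muE e by rw [muE, he.2]]
        field_simp
      rw [this]
      have := mul_lt_mul_of_pos_left (hc j) hs0
      linarith
  have := N.spp_optimal.2 _ _ hfeas
  have := mul_pos hs0 hc0
  linarith

theorem exists_feasible_lt (N : Network m n) : ∃ ψ : N.Edge → ℝ, (∀ e, 0 < ψ e) ∧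
    (∀ i, N.classSum (fun e => N.muE e * ψ e) i = N.lam i) ∧ ∀ j, N.poolSum ψ j < N.beta j := by
  refine ⟨fun e => N.spp e.1.1 e.1.2 / N.muE e, fun e => div_pos e.2 (muE_pos e), fun i => ?_,
    fun j => ?_⟩
  · rw [← N.spp_optimal.1.flow i, ← classSum_eq_sum_pools (N := N) N.spp fun i j h => spp_eq_zero h]
    exact Finset.sum_congr rfl fun e _ => mul_div_cancel₀ _ (muE_pos e).ne'
  · have h := N.spp_optimal.1.load j
    rw [← poolSum_eq_sum_classes (N := N) (fun i j => N.spp i j / (N.beta j * N.mu i j))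
      fun i j h => by simp [spp_eq_zero h]] at h
    have : N.poolSum (fun e => N.spp e.1.1 e.1.2 / N.muE e) j = N.beta j *
        N.poolSum (fun e => N.spp e.1.1 e.1.2 / (N.beta e.1.2 * N.mu e.1.1 e.1.2)) j := by
      rw [poolSum, poolSum, Finset.mul_sum]
      refine Finset.sum_congr rfl fun e he => ?_
      rw [Finset.mem_filter] at he
      have h₁ := muE_pos e
      have h₂ := N.beta_pos j
      rw [he.2, show N.mu e.1.1 j = N.muE e by rw [muE, he.2]]
      field_simp
    rw [this]
    have h₂ := N.beta_pos j
    have := N.rho_lt_one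
    nlinarith

/-- Triangularity provides the solution. Compared with the planning optimum, in which no pool is
full, some pool total does not increase; the pools j < J are full here, so that pool is J, which is
therefore slack. -/
theorem exists_balanced (P : N.Priority) (hN : N.AllActivitiesEssential) :
    ∃ ψ : N.Edge → ℝ, (∀ e, 0 < ψ e) ∧
      (∀ i, N.classSum (fun e => N.muE e * ψ e) i = N.lam i) ∧
      (∀ j, j ≠ Fin.last n → N.poolSum ψ j = N.beta j) ∧
      N.poolSum ψ (Fin.last n) < N.beta (Fin.last n) := by
  obtain ⟨ψ, hψ⟩ := (sums_bijective P fun e => (muE_pos e).ne').2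
    (N.lam, fun j => N.beta j.1)
  have hc : ∀ i, N.classSum (fun e => N.muE e * ψ e) i = N.lam i := fun i =>
    congrFun (congrArg Prod.fst hψ) i
  have hp : ∀ j, j ≠ Fin.last n → N.poolSum ψ j = N.beta j := fun j hj =>
    congrFun (congrArg Prod.snd hψ) ⟨j, hj⟩
  obtain ⟨ψ₀, h0, hc0, hp0⟩ := N.exists_feasible_lt
  have hlast : N.poolSum ψ (Fin.last n) < N.beta (Fin.last n) := by
    obtain ⟨j, hj⟩ := exists_poolSum_nonpos (fun e => ψ e - ψ₀ e) fun i => by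
      have := hc i
      have := hc0 i
      simp only [classSum, mul_sub, Finset.sum_sub_distrib] at *
      linarith
    have hj' : N.poolSum ψ j ≤ N.poolSum ψ₀ j := by
      simpa [poolSum, Finset.sum_sub_distrib] using hj
    have hj2 := hj'.trans_lt (hp0 j)
    by_cases h : j = Fin.last n
    · exact h ▸ hj2
    · exact absurd (hp j h) hj2.ne
  refine ⟨ψ, ?_, hc, hp, hlast⟩
  -- If some component is not positive, `e` is the one that first reaches zero on the segment from
  -- the positive solution `ψ₀` to `ψ`, at parameter `s`. That point satisfies the hypotheses of
  -- `AllActivitiesEssential` but has a zero component.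
  by_contra! hneg
  obtain ⟨e₀, he₀⟩ := hneg
  obtain ⟨e, he, hmin⟩ := Finset.exists_min_image
    (Finset.univ.filter fun e : N.Edge => ψ e ≤ 0) (fun e => ψ₀ e / (ψ₀ e - ψ e))
    ⟨e₀, by simpa using he₀⟩
  simp only [Finset.mem_filter, Finset.mem_univ, true_and] at he hmin
  have hden : ∀ e, ψ e ≤ 0 → 0 < ψ₀ e - ψ e := fun e h => by linarith [h0 e]
  set s := ψ₀ e / (ψ₀ e - ψ e) with hs
  have hs0 : 0 ≤ s := div_nonneg (h0 e).le (hden e he).le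
  have hs1 : s ≤ 1 := (div_le_one (hden e he)).2 (by linarith)
  have key := hN (fun e => (1 - s) * ψ₀ e + s * ψ e) ?_ ?_ ?_ e
  · have : (1 - s) * ψ₀ e + s * ψ e = 0 := by
      rw [hs]
      have := (hden e he).ne'
      field_simp
      ring
    linarith
  · intro e'
    by_cases h : ψ e' ≤ 0
    · have := hmin e' h
      rw [le_div_iff₀ (hden e' h)] at this
      linarith
    · have := h0 e'
      have := not_le.1 h
      have : 0 ≤ 1 - s := by linarith
      positivity
  · intro i
    have h₁ := hc i
    have h₂ := hc0 i
    have : N.classSum (fun e => N.muE e * ((1 - s) * ψ₀ e + s * ψ e)) i =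
        (1 - s) * N.classSum (fun e => N.muE e * ψ₀ e) i +
          s * N.classSum (fun e => N.muE e * ψ e) i := by
      simp only [classSum, Finset.mul_sum, ← Finset.sum_add_distrib]
      exact Finset.sum_congr rfl fun e _ => by ring
    rw [this, h₁, h₂]
    ring
  · intro j
    have : N.poolSum (fun e => (1 - s) * ψ₀ e + s * ψ e) j =
        (1 - s) * N.poolSum ψ₀ j + s * N.poolSum ψ j := by
      simp only [poolSum, Finset.mul_sum, ← Finset.sum_add_distrib]
    rw [this]
    have h₁ := hp0 j
    have h₂ : N.poolSum ψ j ≤ N.beta j := by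
      by_cases h : j = Fin.last n
      · exact h ▸ hlast.le
      · exact (hp j h).le
    nlinarith

/-- At the last activity of a class, the arrival rate still unassigned is exactly `N.muE e * ψ e`;
at any other activity, the capacity remaining in its full pool gives the same value. Positivity of
`ψ` and the pool bounds make the competing term of the minimum at least as large. -/
theorem Priority.eqRate_eq (P : N.Priority) {ψ : N.Edge → ℝ} (h0 : ∀ e, 0 < ψ e)
    (hc : ∀ i, N.classSum (fun e => N.muE e * ψ e) i = N.lam i)
    (hp : ∀ j, j ≠ Fin.last n → N.poolSum ψ j = N.beta j)
    (hlast : N.poolSum ψ (Fin.last n) ≤ N.beta (Fin.last n)) (e : N.Edge) :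
    P.eqRate e = N.muE e * ψ e := by
  have hp' : ∀ j, N.poolSum ψ j ≤ N.beta j := fun j => by
    by_cases h : j = Fin.last n
    · exact h ▸ hlast
    · exact (hp j h).le
  induction e using P.induction with
  | step e ih =>
    have hμ := muE_pos e
    have hsub : ∀ (q : N.Edge → Prop) [DecidablePred q] (f : N.Edge → ℝ),
        ∑ e' : {e' : N.Edge // q e'}, f e'.1 = ∑ e' : N.Edge with q e', f e' :=
      fun q _ f => (Finset.sum_subtype _ (by simp) f).symm
    have h₁ : ∑ e' : {e' : N.Edge // e'.1.1 = e.1.1 ∧ P.prio e' < P.prio e}, P.eqRate e'.1 =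
        ∑ e' : N.Edge with e'.1.1 = e.1.1 ∧ P.prio e' < P.prio e, N.muE e' * ψ e' := by
      rw [← hsub]
      exact Finset.sum_congr rfl fun e' _ => ih e'.1 e'.2.2
    have h₂ : ∑ e' : {e' : N.Edge // e'.1.2 = e.1.2 ∧ P.prio e' < P.prio e},
        P.eqRate e'.1 / N.muE e'.1 =
        ∑ e' : N.Edge with e'.1.2 = e.1.2 ∧ P.prio e' < P.prio e, ψ e' := by
      rw [← hsub]
      exact Finset.sum_congr rfl fun e' _ => by
        rw [ih e'.1 e'.2.2, mul_div_cancel_left₀ _ (muE_pos e'.1).ne']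
    have h₃ := hc e.1.1
    rw [classSum_eq_add (fun e => N.muE e * ψ e) e] at h₃
    have h₄ := poolSum_eq_add ψ e
    have h₅ : ∑ e' : N.Edge with e'.1.1 = e.1.1 ∧ P.prio e' < P.prio e, N.muE e' * ψ e' ≤
        ∑ e' : N.Edge with e'.1.1 = e.1.1 ∧ e' ≠ e, N.muE e' * ψ e' := by
      refine Finset.sum_le_sum_of_subset_of_nonneg (fun e' h => ?_)
        fun e' _ _ => (mul_pos (muE_pos e') (h0 e')).le
      simp only [Finset.mem_filter, Finset.mem_univ, true_and] at h ⊢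
      exact ⟨h.1, fun h' => by simp [h'] at h⟩
    have h₆ : ∑ e' : N.Edge with e'.1.2 = e.1.2 ∧ P.prio e' < P.prio e, ψ e' ≤
        ∑ e' : N.Edge with e'.1.2 = e.1.2 ∧ e' ≠ e, ψ e' := by
      refine Finset.sum_le_sum_of_subset_of_nonneg (fun e' h => ?_) fun e' _ _ => (h0 e').le
      simp only [Finset.mem_filter, Finset.mem_univ, true_and] at h ⊢
      exact ⟨h.1, fun h' => by simp [h'] at h⟩
    rw [Priority.eqRate, h₁, h₂]
    by_cases he : P.IsLast e
    · have h₇ : ∑ e' : N.Edge with e'.1.1 = e.1.1 ∧ P.prio e' < P.prio e, N.muE e' * ψ e' =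
          ∑ e' : N.Edge with e'.1.1 = e.1.1 ∧ e' ≠ e, N.muE e' * ψ e' := by
        refine Finset.sum_congr (Finset.filter_congr fun e' _ => ?_) fun _ _ => rfl
        exact and_congr_right fun h => ⟨fun h' h'' => by simp [h''] at h', he.prio_lt h⟩
      rw [h₇, min_eq_left]
      · linarith
      · have := mul_le_mul_of_nonneg_left
          (show ψ e ≤ N.beta e.1.2 -
            ∑ e' : N.Edge with e'.1.2 = e.1.2 ∧ P.prio e' < P.prio e, ψ e' by
              linarith [hp' e.1.2]) hμ.le
        linarith
    · have h₇ : ∑ e' : N.Edge with e'.1.2 = e.1.2 ∧ P.prio e' < P.prio e, ψ e' =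
          ∑ e' : N.Edge with e'.1.2 = e.1.2 ∧ e' ≠ e, ψ e' := by
        refine Finset.sum_congr (Finset.filter_congr fun e' _ => ?_) fun _ _ => rfl
        exact and_congr_right fun h =>
          ⟨fun h' h'' => by simp [h''] at h', prio_lt_of_not_isLast he h⟩
      rw [hp _ (pool_ne_last_of_not_isLast he)] at h₄
      rw [h₇, show N.beta e.1.2 - ∑ e' : N.Edge with e'.1.2 = e.1.2 ∧ e' ≠ e, ψ e' = ψ e by
        linarith, min_eq_right]
      linarith

theorem Priority.psiStar_spec (P : N.Priority) (hN : N.AllActivitiesEssential) :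
    (∀ e, 0 < P.psiStar e) ∧
      (∀ i, N.classSum (fun e => N.muE e * P.psiStar e) i = N.lam i) ∧
      (∀ j, j ≠ Fin.last n → N.poolSum P.psiStar j = N.beta j) ∧
      N.poolSum P.psiStar (Fin.last n) < N.beta (Fin.last n) := by
  obtain ⟨ψ, h0, hc, hp, hlast⟩ := exists_balanced P hN
  have : P.psiStar = ψ := funext fun e => by
    rw [Priority.psiStar, P.eqRate_eq h0 hc hp hlast.le,
      mul_div_cancel_left₀ _ (muE_pos e).ne']
  rw [this]
  exact ⟨h0, hc, hp, hlast⟩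

end Network

/-! ### Local fluid models: exponential decay and existence. -/

theorem integral_hasDerivWithinAt_Ici_of_continuousOn {g : ℝ → ℝ} (hg : ContinuousOn g (Ici 0))
    {x : ℝ} (hx : 0 ≤ x) : HasDerivWithinAt (fun u => ∫ s in (0 : ℝ)..u, g s) (g x) (Ici x) x := by
  have hsub : Ici x ⊆ Ici 0 := Ici_subset_Ici.2 hx
  refine intervalIntegral.integral_hasDerivWithinAt_right (t := Ioi x) ?_ ?_ ?_
  · exact (hg.mono (by rw [uIcc_of_le hx]; exact Icc_subset_Ici_self)).intervalIntegrable
  · exact ((hg.mono (Ioi_subset_Ici_self.trans hsub)).stronglyMeasurableAtFilter_nhdsWithin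
      measurableSet_Ioi x)
  · exact (hg x hx).mono (Ioi_subset_Ici_self.trans hsub)

/-- Solutions of `y' = -a y + g` decay at the rate of the forcing term `g`, if this rate is less
than `a`. -/
theorem abs_le_of_linear_of_forcing {a c G : ℝ} (hac : c < a) {y g : ℝ → ℝ}
    (hy : ContinuousOn y (Ici 0)) (hg : ContinuousOn g (Ici 0))
    (hyg : ∀ t, 0 ≤ t → y t = y 0 + ∫ s in (0 : ℝ)..t, (-a * y s + g s))
    (hG : ∀ t, 0 ≤ t → |g t| ≤ G * Real.exp (-c * t)) {t : ℝ} (ht : 0 ≤ t) :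
    |y t| ≤ (|y 0| + G / (a - c)) * Real.exp (-c * t) := by
  have hac' : 0 < a - c := sub_pos.2 hac
  have hG0 : 0 ≤ G := by simpa using (abs_nonneg _).trans (hG 0 le_rfl)
  have hcont : ContinuousOn (fun s => -a * y s + g s) (Ici 0) := by fun_prop
  have hderiv : ∀ x, 0 ≤ x → HasDerivWithinAt y (-a * y x + g x) (Ici x) x := fun x hx =>
    ((integral_hasDerivWithinAt_Ici_of_continuousOn hcont hx).const_add (y 0)).congr
      (fun u hu => hyg u (hx.trans hu)) (hyg x hx)
  have hexp : ∀ x, HasDerivAt (fun u => Real.exp (a * u)) (Real.exp (a * x) * a) x := fun x => by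
    simpa using ((hasDerivAt_id x).const_mul a).exp
  have hB : ∀ x, HasDerivAt (fun u => |y 0| + G / (a - c) * Real.exp ((a - c) * u))
      (G * Real.exp ((a - c) * x)) x := fun x => by
    have : HasDerivAt (fun u => Real.exp ((a - c) * u)) (Real.exp ((a - c) * x) * (a - c)) x := by
      simpa using ((hasDerivAt_id x).const_mul (a - c)).exp
    refine ((this.const_mul (G / (a - c))).const_add (|y 0|)).congr_deriv ?_
    field_simp
  -- With the integrating factor `exp (a u)` the derivative becomes `exp (a u) * g u`, whose size is
  -- at most the derivative of the bound in `hB`.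
  have key := image_norm_le_of_norm_deriv_right_le_deriv_boundary
    (f := fun u => Real.exp (a * u) * y u) (a := 0) (b := t)
    (f' := fun x => Real.exp (a * x) * a * y x + Real.exp (a * x) * (-a * y x + g x))
    ((by fun_prop : Continuous fun u => Real.exp (a * u)).continuousOn.mul
      (hy.mono Icc_subset_Ici_self))
    (fun x hx => (hexp x).hasDerivWithinAt.mul (hderiv x hx.1))
    (by simpa using div_nonneg hG0 hac'.le) hB
    (fun x hx => by
      rw [show Real.exp (a * x) * a * y x + Real.exp (a * x) * (-a * y x + g x) =
        Real.exp (a * x) * g x by ring, norm_mul, Real.norm_eq_abs, Real.norm_eq_abs,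
        Real.abs_exp]
      calc Real.exp (a * x) * |g x| ≤ Real.exp (a * x) * (G * Real.exp (-c * x)) :=
            mul_le_mul_of_nonneg_left (hG x hx.1) (Real.exp_pos _).le
        _ = G * Real.exp ((a - c) * x) := by
            rw [show (a - c) * x = a * x + -c * x by ring, Real.exp_add]
            ring) (right_mem_Icc.2 ht)
  rw [norm_mul, Real.norm_eq_abs, Real.norm_eq_abs, Real.abs_exp] at key
  have h₁ : 1 ≤ Real.exp ((a - c) * t) := Real.one_le_exp (by positivity)
  have h₂ : Real.exp (-c * t) = Real.exp ((a - c) * t) / Real.exp (a * t) := by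
    rw [← Real.exp_sub]
    congr 1
    ring
  rw [h₂, mul_div_assoc', le_div_iff₀ (Real.exp_pos _)]
  have := mul_le_mul_of_nonneg_left h₁ (abs_nonneg (y 0))
  linarith

theorem ContinuousLinearMap.exists_hasDerivAt_eq {E : Type*} [NormedAddCommGroup E]
    [NormedSpace ℝ E] [CompleteSpace E] (B : E →L[ℝ] E) (x : E) :
    ∃ f : ℝ → E, f 0 = x ∧ ∀ t, HasDerivAt f (B (f t)) t := by
  refine ⟨fun t => NormedSpace.exp (t • B) x, by simp, fun t => ?_⟩
  exact (ContinuousLinearMap.apply ℝ E x).hasFDerivAt.comp_hasDerivAt t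
    (hasDerivAt_exp_smul_const' (𝕂 := ℝ) B t)

namespace Network

variable {m n : ℕ} {N : Network m n}

theorem abs_psiPart_le_norm (f : N.Vec) (e : N.Edge) : |psiPart f e| ≤ ‖f‖ :=
  PiLp.norm_apply_le f (Sum.inl e)

theorem abs_qPart_le_norm (f : N.Vec) (i : Fin (m + 1)) : |qPart f i| ≤ ‖f‖ :=
  PiLp.norm_apply_le f (Sum.inr i)

/-- The class totals, the totals of all pools but the last one, and the queues. -/
noncomputable def totals : N.Vec →ₗ[ℝ]
    ((Fin (m + 1) → ℝ) × ({j : Fin (n + 1) // j ≠ Fin.last n} → ℝ)) × (Fin (m + 1) → ℝ) where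
  toFun v := (sums (fun _ => 1) (psiPart v), qPart v)
  map_add' v w := Prod.ext ((sums fun _ => 1).map_add (psiPart v) (psiPart w)) rfl
  map_smul' c v := Prod.ext ((sums fun _ => 1).map_smul c (psiPart v)) rfl

theorem totals_injective (P : N.Priority) : Function.Injective (totals (N := N)) := by
  intro v w h
  have h₁ := sums_injective P (w := fun _ => 1) (fun _ => one_ne_zero) (congrArg Prod.fst h)
  have h₂ : qPart v = qPart w := congrArg Prod.snd h
  ext (e | i)
  · exact congrFun h₁ e
  · exact congrFun h₂ i

/-- A vector is controlled by its class totals, the totals of all pools but the last one, and its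
queues. -/
theorem exists_norm_le_of_totals (P : N.Priority) : ∃ K : ℝ, 0 < K ∧ ∀ (v : N.Vec) (a : ℝ),
    (∀ i, |N.classSum (psiPart v) i| ≤ a) →
    (∀ j, j ≠ Fin.last n → |N.poolSum (psiPart v) j| ≤ a) →
    (∀ i, |qPart v i| ≤ a) → ‖v‖ ≤ K * a := by
  obtain ⟨K, hK, hanti⟩ := (totals (N := N)).exists_antilipschitzWith
    (LinearMap.ker_eq_bot.2 (totals_injective P))
  refine ⟨K, hK, fun v a h₁ h₂ h₃ => ?_⟩
  have ha : 0 ≤ a := (abs_nonneg _).trans (h₃ 0)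
  have h := hanti.le_mul_dist v 0
  rw [map_zero, dist_zero_right, dist_zero_right] at h
  refine h.trans (mul_le_mul_of_nonneg_left ?_ hK.le)
  refine norm_prod_le_iff.2 ⟨norm_prod_le_iff.2 ⟨?_, ?_⟩, ?_⟩
  · refine (pi_norm_le_iff_of_nonneg ha).2 fun i => ?_
    simpa [totals, sums] using h₁ i
  · refine (pi_norm_le_iff_of_nonneg ha).2 fun j => ?_
    simpa [totals, sums] using h₂ j.1 j.2
  · exact (pi_norm_le_iff_of_nonneg ha).2 h₃

/-- The defining properties of local fluid models, with continuity in place of the Lipschitz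
property. -/
structure IsFluidSolution (N : Network m n) (f : ℝ → N.Vec) : Prop where
  continuous : ContinuousOn f (Ici 0)
  queues : ∀ t, 0 ≤ t → ∀ i, qPart (f t) i = 0
  dynamics : ∀ t, 0 ≤ t → ∀ i, N.classSum (psiPart (f t)) i =
    N.classSum (psiPart (f 0)) i -
      N.classSum (fun e => ∫ s in (0 : ℝ)..t, N.muE e * psiPart (f s) e) i
  pools : ∀ t, 0 ≤ t → ∀ j, j < Fin.last n → N.poolSum (psiPart (f t)) j = 0

theorem IsLocalFluidModel.isFluidSolution {f : ℝ → N.Vec} (h : N.IsLocalFluidModel f) :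
    N.IsFluidSolution f :=
  ⟨h.lipschitz.choose_spec.continuousOn, h.queues, h.dynamics, h.pools⟩

namespace IsFluidSolution

variable {f g : ℝ → N.Vec}

theorem continuousOn_psiPart (h : N.IsFluidSolution f) (e : N.Edge) :
    ContinuousOn (fun t => psiPart (f t) e) (Ici 0) :=
  (EuclideanSpace.proj (𝕜 := ℝ) (Sum.inl e : N.Edge ⊕ Fin (m + 1))).continuous.comp_continuousOn
    h.continuous

theorem intervalIntegrable (h : N.IsFluidSolution f) (e : N.Edge) (c : ℝ) {t : ℝ} (ht : 0 ≤ t) :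
    IntervalIntegrable (fun s => c * psiPart (f s) e) MeasureTheory.volume 0 t :=
  (((h.continuousOn_psiPart e).mono
    (by rw [uIcc_of_le ht]; exact Icc_subset_Ici_self)).intervalIntegrable).const_mul c

theorem sub (hf : N.IsFluidSolution f) (hg : N.IsFluidSolution g) :
    N.IsFluidSolution fun t => f t - g t := by
  have hψ : ∀ t, psiPart (f t - g t) = fun e => psiPart (f t) e - psiPart (g t) e := fun t => rfl
  refine ⟨hf.continuous.sub hg.continuous, fun t ht i => ?_, fun t ht i => ?_,
    fun t ht j hj => ?_⟩
  · have : qPart (f t - g t) i = qPart (f t) i - qPart (g t) i := rfl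
    rw [this, hf.queues t ht, hg.queues t ht, sub_zero]
  · have h₁ := hf.dynamics t ht i
    have h₂ := hg.dynamics t ht i
    simp only [hψ, mul_sub]
    have : ∀ e, ∫ s in (0 : ℝ)..t, (N.muE e * psiPart (f s) e - N.muE e * psiPart (g s) e) =
        (∫ s in (0 : ℝ)..t, N.muE e * psiPart (f s) e) -
          ∫ s in (0 : ℝ)..t, N.muE e * psiPart (g s) e := fun e =>
      intervalIntegral.integral_sub (hf.intervalIntegrable e _ ht) (hg.intervalIntegrable e _ ht)
    simp only [this]
    simp only [classSum, Finset.sum_sub_distrib] at *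
    linarith
  · have h₁ := hf.pools t ht j hj
    have h₂ := hg.pools t ht j hj
    simp only [hψ]
    simp only [poolSum, Finset.sum_sub_distrib] at *
    linarith

end IsFluidSolution

theorem exists_rate_lt_muE (N : Network m n) : ∃ c : ℝ, 0 < c ∧ ∀ e : N.Edge, c < N.muE e := by
  have : ∀ᶠ c : ℝ in 𝓝[>] 0, ∀ e : N.Edge, c < N.muE e := by
    rw [eventually_all]
    exact fun e => (tendsto_id.mono_left nhdsWithin_le_nhds).eventually_lt_const (muE_pos e)
  obtain ⟨c, hc, hc0⟩ := (this.and self_mem_nhdsWithin).exists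
  exact ⟨c, hc0, hc⟩

/-- Induction on priority. If `e` is last of its class, the class total solves x' = -μ x + g, where
μ is the rate of `e` and g is a combination of components of higher priority; `c < N.muE e` lets the
decay rate of g pass to x without loss. Otherwise the vanishing pool sum expresses the component
through those of higher priority. -/
theorem exists_component_decay (P : N.Priority) {c : ℝ} (hc : ∀ e : N.Edge, c < N.muE e)
    (e : N.Edge) : ∃ C : ℝ, 0 ≤ C ∧ ∀ f, N.IsFluidSolution f → ∀ t, 0 ≤ t →
      |psiPart (f t) e| ≤ C * ‖f 0‖ * Real.exp (-c * t) := by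
  induction e using P.induction with
  | step e ih =>
    choose! C hC0 hC using ih
    by_cases he : P.IsLast e
    · let S := Finset.univ.filter fun e' : N.Edge => e'.1.1 = e.1.1 ∧ e' ≠ e
      have hS : ∀ e' ∈ S, P.prio e' < P.prio e := fun e' h => by
        rw [Finset.mem_filter] at h
        exact he.prio_lt h.2.1 h.2.2
      let A := ∑ e' ∈ S, |N.muE e - N.muE e'| * C e'
      let B := ∑ e' ∈ S, C e'
      have hA : 0 ≤ A := Finset.sum_nonneg fun e' h =>
        mul_nonneg (abs_nonneg _) (hC0 e' (hS e' h))
      have hB : 0 ≤ B := Finset.sum_nonneg fun e' h => hC0 e' (hS e' h)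
      have hpos : 0 < N.muE e - c := sub_pos.2 (hc e)
      refine ⟨(Fintype.card N.Edge + A / (N.muE e - c)) + B, by positivity, fun f hf t ht => ?_⟩
      have hx0 : |N.classSum (psiPart (f 0)) e.1.1| ≤ Fintype.card N.Edge * ‖f 0‖ := by
        refine (Finset.abs_sum_le_sum_abs _ _).trans ?_
        refine (Finset.sum_le_card_nsmul _ _ ‖f 0‖ fun e' _ => abs_psiPart_le_norm _ _).trans ?_
        rw [nsmul_eq_mul]
        exact mul_le_mul_of_nonneg_right (by exact_mod_cast Finset.card_le_univ _)
          (norm_nonneg _)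
      have hx := abs_le_of_linear_of_forcing (hc e)
        (y := fun t => N.classSum (psiPart (f t)) e.1.1)
        (g := fun t => ∑ e' ∈ S, (N.muE e - N.muE e') * psiPart (f t) e') (G := A * ‖f 0‖)
        (continuousOn_finsetSum _ fun e' _ => hf.continuousOn_psiPart e')
        (continuousOn_finsetSum _ fun e' _ => (hf.continuousOn_psiPart e').const_mul _)
        (fun u hu => by
          rw [hf.dynamics u hu, sub_eq_add_neg, classSum.eq_1 N (fun e => ∫ s in (0 : ℝ)..u, _),
            ← intervalIntegral.integral_finsetSum fun e' _ => hf.intervalIntegrable e' _ hu,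
            ← intervalIntegral.integral_neg]
          congr 1
          refine intervalIntegral.integral_congr fun s _ => ?_
          have h₁ := classSum_eq_add (psiPart (f s)) e
          have h₂ := classSum_eq_add (fun e => N.muE e * psiPart (f s) e) e
          simp only [sub_mul, Finset.sum_sub_distrib, ← Finset.mul_sum]
          change -N.classSum (fun e => N.muE e * psiPart (f s) e) e.1.1 =
            -N.muE e * N.classSum (psiPart (f s)) e.1.1 +
              (N.muE e * ∑ e' ∈ S, psiPart (f s) e' - ∑ e' ∈ S, N.muE e' * psiPart (f s) e')
          rw [h₁, h₂]
          ring)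
        (fun u hu => by
          refine (Finset.abs_sum_le_sum_abs _ _).trans ?_
          simp only [A, Finset.sum_mul]
          refine Finset.sum_le_sum fun e' he' => ?_
          rw [abs_mul, mul_assoc, mul_assoc]
          refine mul_le_mul_of_nonneg_left ?_ (abs_nonneg _)
          rw [← mul_assoc]
          exact hC e' (hS e' he') f hf u hu) ht
      have hoth : |∑ e' ∈ S, psiPart (f t) e'| ≤ B * ‖f 0‖ * Real.exp (-c * t) := by
        refine (Finset.abs_sum_le_sum_abs _ _).trans ?_
        simp only [B, Finset.sum_mul]
        exact Finset.sum_le_sum fun e' he' => hC e' (hS e' he') f hf t ht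
      have hsum := classSum_eq_add (psiPart (f t)) e
      have hψ : psiPart (f t) e =
          N.classSum (psiPart (f t)) e.1.1 - ∑ e' ∈ S, psiPart (f t) e' := by
        rw [hsum]
        ring
      rw [hψ]
      refine (abs_sub _ _).trans ?_
      have hexp := Real.exp_pos (-c * t)
      have := mul_le_mul_of_nonneg_right hx0 hexp.le
      have h3 : (|N.classSum (psiPart (f 0)) e.1.1| + A * ‖f 0‖ / (N.muE e - c)) *
          Real.exp (-c * t) ≤ (Fintype.card N.Edge * ‖f 0‖ + A * ‖f 0‖ / (N.muE e - c)) *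
          Real.exp (-c * t) := by
        gcongr
      calc _ ≤ (Fintype.card N.Edge * ‖f 0‖ + A * ‖f 0‖ / (N.muE e - c)) *
          Real.exp (-c * t) + B * ‖f 0‖ * Real.exp (-c * t) := add_le_add (hx.trans h3) hoth
        _ = _ := by ring
    · let S := Finset.univ.filter fun e' : N.Edge => e'.1.2 = e.1.2 ∧ e' ≠ e
      have hS : ∀ e' ∈ S, P.prio e' < P.prio e := fun e' h => by
        rw [Finset.mem_filter] at h
        exact Priority.prio_lt_of_not_isLast he h.2.1 h.2.2
      refine ⟨∑ e' ∈ S, C e', Finset.sum_nonneg fun e' h => hC0 e' (hS e' h), fun f hf t ht => ?_⟩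
      have hsum := poolSum_eq_add (psiPart (f t)) e
      rw [hf.pools t ht _ (lt_of_le_of_ne (Fin.le_last _)
        (Priority.pool_ne_last_of_not_isLast he))] at hsum
      have hψ : psiPart (f t) e = -∑ e' ∈ S, psiPart (f t) e' := by
        change 0 = psiPart (f t) e + ∑ e' ∈ S, psiPart (f t) e' at hsum
        linarith
      rw [hψ, abs_neg, Finset.sum_mul, Finset.sum_mul]
      refine (Finset.abs_sum_le_sum_abs _ _).trans ?_
      exact Finset.sum_le_sum fun e' he' => hC e' (hS e' he') f hf t ht

theorem exists_decay (P : N.Priority) : ∃ c₁ c₂ : ℝ, 0 < c₁ ∧ 0 < c₂ ∧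
    ∀ f : ℝ → N.Vec, N.IsFluidSolution f →
      ∀ t, 0 ≤ t → ‖f t‖ ≤ ‖f 0‖ * (c₁ * Real.exp (-c₂ * t)) := by
  obtain ⟨c, hc0, hc⟩ := N.exists_rate_lt_muE
  choose C hC0 hC using exists_component_decay P hc
  obtain ⟨K, hK, hbound⟩ := exists_norm_le_of_totals P
  have hCs : 0 ≤ ∑ e, C e := Finset.sum_nonneg fun e _ => hC0 e
  refine ⟨K * (∑ e, C e + 1), c, by positivity, hc0, fun f hf t ht => ?_⟩
  have hexp := Real.exp_pos (-c * t)
  have hsum : ∀ s : Finset N.Edge, |∑ e ∈ s, psiPart (f t) e| ≤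
      (∑ e, C e + 1) * ‖f 0‖ * Real.exp (-c * t) := by
    intro s
    refine (Finset.abs_sum_le_sum_abs _ _).trans ?_
    refine (Finset.sum_le_sum fun e _ => hC e f hf t ht).trans ?_
    rw [← Finset.sum_mul, ← Finset.sum_mul]
    have : ∑ e ∈ s, C e ≤ ∑ e, C e + 1 :=
      (Finset.sum_le_univ_sum_of_nonneg hC0).trans (by linarith)
    gcongr
  calc ‖f t‖ ≤ K * ((∑ e, C e + 1) * ‖f 0‖ * Real.exp (-c * t)) :=
        hbound _ _ (fun i => hsum _) (fun j _ => hsum _) fun i => by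
          rw [hf.queues t ht, abs_zero]
          positivity
    _ = _ := by ring

/-- The linear differential equation behind the local fluid models can be solved. -/
theorem exists_linear_flow (P : N.Priority) (f₀ : N.Vec) : ∃ (B : N.Vec →L[ℝ] N.Vec)
    (f : ℝ → N.Vec), f 0 = f₀ ∧ (∀ t, HasDerivAt f (B (f t)) t) ∧
      (∀ v i, N.classSum (psiPart (B v)) i = -N.classSum (fun e => N.muE e * psiPart v e) i) ∧
      (∀ v j, j ≠ Fin.last n → N.poolSum (psiPart (B v)) j = 0) ∧
      ∀ v i, qPart (B v) i = 0 := by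
  let T := LinearEquiv.ofBijective _ (sums_bijective P (w := fun _ => 1) fun _ => one_ne_zero)
  let D : N.Vec →ₗ[ℝ] (Fin (m + 1) → ℝ) × ({j : Fin (n + 1) // j ≠ Fin.last n} → ℝ) :=
    { toFun := fun v => (fun i => -N.classSum (fun e => N.muE e * psiPart v e) i, 0)
      map_add' := fun v w => by
        ext i
        · simp [classSum, psiPart, mul_add, Finset.sum_add_distrib]
          ring
        · simp
      map_smul' := fun c v => by
        ext i
        · simp [classSum, psiPart, Finset.mul_sum, mul_left_comm]
        · simp }
  let E : (N.Edge → ℝ) →ₗ[ℝ] N.Vec :=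
    { toFun := fun ψ => WithLp.toLp 2 (Sum.elim ψ 0)
      map_add' := fun v w => by ext (e | i) <;> simp
      map_smul' := fun c v => by ext (e | i) <;> simp }
  -- `B v` is the vector without queue part whose class totals are minus the service rates of `v`
  -- and whose pool sums for j < J vanish.
  let B : N.Vec →L[ℝ] N.Vec := (E ∘ₗ T.symm.toLinearMap ∘ₗ D).toContinuousLinearMap
  have hB : ∀ v, sums (fun _ => 1) (psiPart (B v)) = D v := fun v => T.apply_symm_apply (D v)
  obtain ⟨f, hf0, hf⟩ := B.exists_hasDerivAt_eq f₀
  refine ⟨B, f, hf0, hf, fun v i => ?_, fun v j hj => ?_, fun v i => rfl⟩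
  · have := congrFun (congrArg Prod.fst (hB v)) i
    simpa [sums, D] using this
  · exact congrFun (congrArg Prod.snd (hB v)) ⟨j, hj⟩

theorem exists_isLocalFluidModel (P : N.Priority) {f₀ : N.Vec} (hq : ∀ i, qPart f₀ i = 0)
    (hp : ∀ j, j < Fin.last n → N.poolSum (psiPart f₀) j = 0) :
    ∃ f : ℝ → N.Vec, f 0 = f₀ ∧ N.IsLocalFluidModel f := by
  obtain ⟨B, f, hf0, hf, hc, hpool, hqB⟩ := exists_linear_flow P f₀
  have hcont : Continuous f := continuous_iff_continuousAt.2 fun t => (hf t).continuousAt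
  have hψ : ∀ e t, HasDerivAt (fun u => psiPart (f u) e) (psiPart (B (f t)) e) t := fun e t =>
    (EuclideanSpace.proj (𝕜 := ℝ) (Sum.inl e : N.Edge ⊕ Fin (m + 1))).hasFDerivAt.comp_hasDerivAt
      t (hf t)
  have hqd : ∀ i t, HasDerivAt (fun u => qPart (f u) i) (qPart (B (f t)) i) t := fun i t =>
    (EuclideanSpace.proj (𝕜 := ℝ) (Sum.inr i : N.Edge ⊕ Fin (m + 1))).hasFDerivAt.comp_hasDerivAt
      t (hf t)
  have hψc : ∀ e, Continuous fun u => psiPart (f u) e := fun e =>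
    continuous_iff_continuousAt.2 fun t => (hψ e t).continuousAt
  have hconst : ∀ u : ℝ → ℝ, (∀ t, HasDerivAt u 0 t) → ∀ t, u t = u 0 := fun u hu t =>
    is_const_of_deriv_eq_zero (fun x => (hu x).differentiableAt) (fun x => (hu x).deriv) t 0
  have hsol : N.IsFluidSolution f := by
    refine ⟨hcont.continuousOn, fun t _ i => ?_, fun t ht i => ?_, fun t _ j hj => ?_⟩
    · rw [hconst (fun u => qPart (f u) i) (fun t => hqB (f t) i ▸ hqd i t) t, hf0, hq]
    · have hd : ∀ t, HasDerivAt (fun u => N.classSum (psiPart (f u)) i)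
          (-N.classSum (fun e => N.muE e * psiPart (f t) e) i) t := fun t => by
        rw [← hc]
        exact HasDerivAt.fun_sum fun e _ => hψ e t
      have h := intervalIntegral.integral_eq_sub_of_hasDerivAt (a := 0) (b := t)
        (fun u _ => hd u) (Continuous.intervalIntegrable
          (continuous_finsetSum _ fun e _ => (hψc e).const_mul _).neg _ _)
      rw [intervalIntegral.integral_neg] at h
      simp only [classSum] at h ⊢
      rw [intervalIntegral.integral_finsetSum fun e _ =>
        ((hψc e).const_mul _).intervalIntegrable _ _] at h
      linarith
    · have hd : ∀ t, HasDerivAt (fun u => N.poolSum (psiPart (f u)) j) 0 t := fun t => by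
        rw [← hpool (f t) j hj.ne]
        exact HasDerivAt.fun_sum fun e _ => hψ e t
      rw [hconst _ hd t, hf0, hp j hj]
  -- Continuity alone already gives the decay estimate; this bounds `f`, hence its derivative `B (f
  -- t)`, and so provides the Lipschitz constant.
  obtain ⟨c₁, c₂, hc₁, hc₂, hdecay⟩ := exists_decay P
  refine ⟨f, hf0, ⟨(‖B‖₊ * (‖f 0‖₊ * Real.toNNReal c₁)), ?_⟩, hsol.queues, hsol.dynamics,
    hsol.pools⟩
  refine (convex_Ici 0).lipschitzOnWith_of_nnnorm_hasDerivWithin_le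
    (fun t _ => (hf t).hasDerivWithinAt) fun t ht => ?_
  rw [← NNReal.coe_le_coe]
  push_cast
  rw [Real.coe_toNNReal _ hc₁.le]
  refine (B.le_opNorm _).trans (mul_le_mul_of_nonneg_left ((hdecay f hsol t ht).trans ?_)
    (norm_nonneg _))
  refine mul_le_mul_of_nonneg_left (mul_le_of_le_one_right hc₁.le ?_) (norm_nonneg _)
  rw [Real.exp_le_one_iff, neg_mul, neg_nonpos]
  exact mul_nonneg hc₂.le ht

end Network

/-! ### Sample paths: events, balance equations and excursions. -/

/-- Continuous induction on `[0, ∞)`. -/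
theorem continuous_induction {p : ℝ → Prop} (h0 : p 0)
    (hr : ∀ t, 0 ≤ t → p t → ∀ᶠ u in 𝓝[>] t, p u)
    (hl : ∀ t, 0 < t → (∀ u, 0 ≤ u → u < t → p u) → p t) {t : ℝ} (ht : 0 ≤ t) : p t := by
  by_contra hpt
  let S := {u : ℝ | 0 ≤ u ∧ ¬ p u}
  have hne : S.Nonempty := ⟨t, ht, hpt⟩
  have hbdd : BddBelow S := ⟨0, fun u hu => hu.1⟩
  have hs0 : 0 ≤ sInf S := le_csInf hne fun u hu => hu.1
  have hlt : ∀ u, 0 ≤ u → u < sInf S → p u := fun u hu h =>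
    by_contra fun hp => notMem_of_lt_csInf h hbdd ⟨hu, hp⟩
  have hps : p (sInf S) := by
    rcases hs0.eq_or_lt with h | h
    · exact h ▸ h0
    · exact hl _ h hlt
  obtain ⟨b, hb, hsub⟩ := mem_nhdsGT_iff_exists_Ioo_subset.1 (hr _ hs0 hps)
  have : b ≤ sInf S := le_csInf hne fun u hu => by
    by_contra hub
    rcases (csInf_le hbdd hu).eq_or_lt with h | h
    · exact hu.2 (h ▸ hps)
    · exact hu.2 (hsub ⟨h, not_le.1 hub⟩)
  exact absurd this (not_le.2 hb)

namespace Network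

variable {m n : ℕ} {N : Network m n} {P : N.Priority} {r : ℝ}

/-- One event (or none): the state changes from `s` to `s'`, and `da`, `dd` are the increments of
the arrival and departure counts. -/
def Priority.Step (P : N.Priority) (r : ℝ) (s s' : N.State) (da : Fin (m + 1) → ℕ)
    (dd : N.Edge → ℕ) : Prop :=
  (da = 0 ∧ dd = 0 ∧ s' = s) ∨
  (∃ i, da = Pi.single i 1 ∧ dd = 0 ∧ P.ArrivalStep r i s s') ∨
  (∃ e, da = 0 ∧ dd = Pi.single e 1 ∧ DepartureStep e s s')

theorem poolSum_add (f g : N.Edge → ℕ) (j : Fin (n + 1)) :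
    N.poolSum (f + g) j = N.poolSum f j + N.poolSum g j :=
  Finset.sum_add_distrib

theorem classSum_add (f g : N.Edge → ℕ) (i : Fin (m + 1)) :
    N.classSum (f + g) i = N.classSum f i + N.classSum g i :=
  Finset.sum_add_distrib

theorem poolSum_zero (j : Fin (n + 1)) : N.poolSum (0 : N.Edge → ℕ) j = 0 :=
  Finset.sum_const_zero

theorem poolSum_single (e : N.Edge) (j : Fin (n + 1)) :
    N.poolSum (Pi.single e 1) j = if e.1.2 = j then 1 else 0 := by
  rw [poolSum, Finset.sum_pi_single']
  simp

theorem classSum_single (e : N.Edge) (i : Fin (m + 1)) :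
    N.classSum (Pi.single e 1) i = if e.1.1 = i then 1 else 0 := by
  rw [classSum, Finset.sum_pi_single']
  simp

/-- A departure with replacement leaves the pool totals unchanged. -/
theorem poolSum_eq_of_replacement {s s' : N.State} {e e' : N.Edge} (hp : e'.1.2 = e.1.2)
    (h : s'.psi + Pi.single e 1 = s.psi + Pi.single e' 1) (j : Fin (n + 1)) :
    N.poolSum s'.psi j = N.poolSum s.psi j := by
  have := congrArg (fun f => N.poolSum f j) h
  simp only [poolSum_add, poolSum_single, hp] at this
  omega

theorem poolSum_of_departure {s s' : N.State} {e : N.Edge}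
    (h : s'.psi + Pi.single e 1 = s.psi) (j : Fin (n + 1)) :
    N.poolSum s.psi j = N.poolSum s'.psi j + if e.1.2 = j then 1 else 0 := by
  rw [← h, poolSum_add, poolSum_single]

theorem poolSum_of_arrival {s s' : N.State} {e : N.Edge}
    (h : s'.psi = s.psi + Pi.single e 1) (j : Fin (n + 1)) :
    N.poolSum s'.psi j = N.poolSum s.psi j + if e.1.2 = j then 1 else 0 := by
  rw [h, poolSum_add, poolSum_single]

namespace Priority.Step

variable {s s' : N.State} {da : Fin (m + 1) → ℕ} {dd : N.Edge → ℕ}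

theorem admissible (h : P.Step r s s' da dd) (hs : s.Admissible r) : s'.Admissible r := by
  rcases h with ⟨-, -, rfl⟩ | ⟨i, -, -, ⟨e, -, hidle, -, hψ, hq⟩ | ⟨hfull, hψ, hq⟩⟩ |
    ⟨e, -, -, -, ⟨e', hp, -, -, hψ, hq⟩ | ⟨hq0, hψ, hq⟩⟩
  · exact hs
  · refine ⟨fun j => ?_, fun e' he' => ?_⟩
    · rw [poolSum_of_arrival hψ]
      split_ifs with h
      · exact h ▸ hidle
      · exact hs.1 j
    · rw [hq] at he'
      have h := hs.2 e' he'
      rw [poolSum_of_arrival hψ, if_neg, h, add_zero]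
      rintro h'
      exact absurd (h' ▸ h) hidle.ne
  · refine ⟨fun j => hψ ▸ hs.1 j, fun e' he' => ?_⟩
    rw [hψ]
    by_cases h : e'.1.1 = i
    · exact le_antisymm (hs.1 _) (not_lt.1 (hfull e' h))
    · rw [hq] at he'
      exact hs.2 e' (by simpa [Pi.single_eq_of_ne h] using he')
  · refine ⟨fun j => poolSum_eq_of_replacement hp hψ j ▸ hs.1 j, fun e'' he'' => ?_⟩
    rw [poolSum_eq_of_replacement hp hψ]
    refine hs.2 e'' (he''.trans_le ?_)
    rw [← hq]
    exact Nat.le_add_right _ _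
  · refine ⟨fun j => (Nat.le_add_right _ _).trans ((poolSum_of_departure hψ j).symm.le.trans
      (hs.1 j)), fun e' he' => ?_⟩
    rw [hq] at he'
    have h := hs.2 e' he'
    rw [poolSum_of_departure hψ, if_neg, add_zero] at h
    · exact h
    · rintro h'
      exact he'.ne' (hq0 e' h'.symm)

/-- Balance of the number of customers of a class. -/
theorem class_balance (h : P.Step r s s' da dd) (i : Fin (m + 1)) :
    N.classSum s'.psi i + s'.q i + N.classSum dd i = N.classSum s.psi i + s.q i + da i := by
  rcases h with ⟨rfl, rfl, rfl⟩ | ⟨i', rfl, rfl, ⟨e, rfl, -, -, hψ, hq⟩ | ⟨-, hψ, hq⟩⟩ |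
    ⟨e, rfl, rfl, -, ⟨e', hp, -, -, hψ, hq⟩ | ⟨-, hψ, hq⟩⟩
  · simp [classSum]
  · rw [hψ, hq, classSum_add, classSum_single, Pi.single_apply]
    simp only [classSum, Pi.zero_apply, Finset.sum_const_zero, eq_comm (a := i)]
    omega
  · rw [hψ, hq, Pi.add_apply, Pi.single_apply]
    simp only [classSum, Pi.zero_apply, Finset.sum_const_zero]
    omega
  · have h₁ := congrArg (fun f => N.classSum f i) hψ
    have h₂ := congrFun hq i
    simp only [classSum_add, classSum_single, Pi.add_apply, Pi.single_apply,
      eq_comm (a := i)] at h₁ h₂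
    rw [classSum_single, Pi.zero_apply]
    omega
  · rw [hq, ← hψ, classSum_add, Pi.zero_apply]
    omega

theorem psi_le (h : P.Step r s s' da dd) (e : N.Edge) :
    s'.psi e ≤ s.psi e + 1 ∧ s.psi e ≤ s'.psi e + 1 := by
  have hle : ∀ e' : N.Edge, (Pi.single e' 1 : N.Edge → ℕ) e ≤ 1 := fun e' => by
    rw [Pi.single_apply]
    split_ifs <;> omega
  rcases h with ⟨-, -, rfl⟩ | ⟨i', -, -, ⟨e', -, -, -, hψ, -⟩ | ⟨-, hψ, -⟩⟩ |
    ⟨e', -, -, -, ⟨e'', -, -, -, hψ, -⟩ | ⟨-, hψ, -⟩⟩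
  · omega
  · have := hle e'
    rw [hψ, Pi.add_apply]
    omega
  · rw [hψ]
    omega
  · have h₁ := congrFun hψ e
    have h₂ := hle e'
    have h₃ := hle e''
    rw [Pi.add_apply, Pi.add_apply] at h₁
    omega
  · have h₁ := congrFun hψ e
    have h₂ := hle e'
    rw [Pi.add_apply] at h₁
    omega

theorem q_le (h : P.Step r s s' da dd) (i : Fin (m + 1)) : s'.q i ≤ s.q i + 1 := by
  rcases h with ⟨-, -, rfl⟩ | ⟨i', -, -, ⟨e, -, -, -, -, hq⟩ | ⟨-, -, hq⟩⟩ |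
    ⟨e, -, -, -, ⟨e', -, -, -, -, hq⟩ | ⟨-, -, hq⟩⟩
  · omega
  · rw [hq]; omega
  · rw [hq, Pi.add_apply, Pi.single_apply]; split_ifs <;> omega
  · have := congrFun hq i
    rw [Pi.add_apply] at this
    omega
  · rw [hq]; omega

theorem poolSum_le (h : P.Step r s s' da dd) (j : Fin (n + 1)) :
    N.poolSum s.psi j ≤ N.poolSum s'.psi j + 1 := by
  rcases h with ⟨-, -, rfl⟩ | ⟨i', -, -, ⟨e, -, -, -, hψ, -⟩ | ⟨-, hψ, -⟩⟩ |
    ⟨e, -, -, -, ⟨e', hp, -, -, hψ, -⟩ | ⟨-, hψ, -⟩⟩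
  · omega
  · rw [poolSum_of_arrival hψ]; omega
  · rw [hψ]; omega
  · rw [poolSum_eq_of_replacement hp hψ]; omega
  · rw [poolSum_of_departure hψ]; split_ifs <;> omega

end Priority.Step

/-- The number of customers of the classes in `C` waiting plus the number of customers in the
pools in `B`. -/
noncomputable def State.content (s : N.State) (C : Finset (Fin (m + 1))) (B : Finset (Fin (n + 1))) : ℕ :=
  ∑ i ∈ C, s.q i + ∑ j ∈ B, N.poolSum s.psi j

/-- The content of `(C, B)` increases by one at arrivals of classes in `C` and decreases by one at
departures from pools in `B`, provided that customers of classes in `C` do not enter other pools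
and pools in `B` do not accept customers of other classes. -/
theorem Priority.Step.content_balance {s s' : N.State} {da : Fin (m + 1) → ℕ} {dd : N.Edge → ℕ}
    (h : P.Step r s s' da dd) (C : Finset (Fin (m + 1))) (B : Finset (Fin (n + 1)))
    (harr : ∀ e : N.Edge, s.HasIdle r e.1.2 →
      (∀ e' : N.Edge, e'.1.1 = e.1.1 → s.HasIdle r e'.1.2 → P.prio e ≤ P.prio e') →
      (e.1.1 ∈ C ↔ e.1.2 ∈ B))
    (hdep : ∀ e : N.Edge, 0 < s.q e.1.1 →
      (∀ e' : N.Edge, e'.1.2 = e.1.2 → 0 < s.q e'.1.1 → e.1.1 ≤ e'.1.1) →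
      (e.1.1 ∈ C ↔ e.1.2 ∈ B)) :
    s'.content C B + ∑ j ∈ B, N.poolSum dd j = s.content C B + ∑ i ∈ C, da i := by
  have hite : ∀ k : Fin (n + 1), ∑ j ∈ B, (if k = j then 1 else 0) = if k ∈ B then 1 else 0 :=
    fun k => Finset.sum_ite_eq B k fun _ => 1
  unfold State.content
  rcases h with ⟨rfl, rfl, rfl⟩ | ⟨i, rfl, rfl, ⟨e, rfl, hidle, hmin, hψ, hq⟩ | ⟨-, hψ, hq⟩⟩ |
    ⟨e, rfl, rfl, -, ⟨e', hp, hq0, hmin, hψ, hq⟩ | ⟨-, hψ, hq⟩⟩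
  · simp [poolSum]
  · have := harr e hidle hmin
    simp only [poolSum_of_arrival hψ, hq, Finset.sum_add_distrib, hite, Finset.sum_pi_single',
      this, poolSum_zero, Finset.sum_const_zero]
    omega
  · simp only [hψ, hq, Finset.sum_add_distrib, Pi.add_apply, Finset.sum_pi_single', poolSum_zero,
      Finset.sum_const_zero]
    omega
  · have hiff := hdep e' hq0 (fun e'' h => hmin e'' (h.trans hp))
    rw [hp] at hiff
    have : ∑ i ∈ C, s.q i = ∑ i ∈ C, s'.q i + if e.1.2 ∈ B then 1 else 0 := by
      rw [← hq]
      simp only [Pi.add_apply, Finset.sum_add_distrib, Finset.sum_pi_single', hiff]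
    simp only [poolSum_eq_of_replacement hp hψ, poolSum_single, hite, this, Pi.zero_apply,
      Finset.sum_const_zero]
    omega
  · simp only [poolSum_of_departure hψ, hq, Finset.sum_add_distrib, poolSum_single, hite,
      Pi.zero_apply, Finset.sum_const_zero]
    omega

theorem IsCountingPath.eventually_eq {p : ℝ → ℕ} (hp : IsCountingPath p) {t a c : ℝ}
    (ha : 0 ≤ a) (hc : 0 ≤ c) : ∀ᶠ u in 𝓝[>] t, p (a + c * (u - t)) = p a := by
  rcases hc.eq_or_lt with rfl | hc
  · simp
  · have h : Tendsto (fun u => a + c * (u - t)) (𝓝[>] t) (𝓝[>] a) := by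
      refine tendsto_nhdsWithin_iff.2 ⟨?_, ?_⟩
      · have : Continuous fun u => a + c * (u - t) := by fun_prop
        simpa using (this.tendsto t).mono_left nhdsWithin_le_nhds
      · filter_upwards [self_mem_nhdsWithin] with u hu
        have : 0 < u - t := sub_pos.2 hu
        have := mul_pos hc this
        simp only [mem_Ioi]
        linarith
    exact h.eventually (hp.right a ha)

namespace Realization

variable (R : Realization P r)

theorem exists_state_eq_right {t : ℝ} (ht : 0 ≤ t) :
    ∃ b, t < b ∧ ∀ u, t ≤ u → u < b → R.state u = R.state t := by
  obtain ⟨b, hb, hsub⟩ := mem_nhdsGT_iff_exists_Ioo_subset.1 (R.right t ht)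
  refine ⟨b, hb, fun u hu hub => ?_⟩
  rcases hu.eq_or_lt with rfl | h
  · rfl
  · exact hsub ⟨h, hub⟩

theorem intervalIntegrable_comp {E : Type*} [NormedAddCommGroup E] (F : N.State → E) {t : ℝ}
    (ht : 0 ≤ t) : IntervalIntegrable (fun u => F (R.state u)) MeasureTheory.volume 0 t := by
  refine continuous_induction (p := fun t => IntervalIntegrable
    (fun u => F (R.state u)) MeasureTheory.volume 0 t)
    IntervalIntegrable.refl (fun t ht h => ?_) (fun t ht h => ?_) ht
  · obtain ⟨b, hb, hconst⟩ := R.exists_state_eq_right ht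
    filter_upwards [Ioo_mem_nhdsGT hb] with u hu
    refine h.trans ((intervalIntegrable_const
      (c := F (R.state t))).congr_uIoo fun v hv => ?_)
    rw [uIoo_of_le hu.1.le] at hv
    simp only [hconst v hv.1.le (hv.2.trans hu.2)]
  · obtain ⟨s, a, d, hs, -⟩ := R.event t ht
    obtain ⟨b, hb, hsub⟩ := mem_nhdsLT_iff_exists_Ioo_subset.1 (hs.mono fun u hu => hu.1)
    have hbt : max b 0 < t := max_lt hb ht
    refine (h _ (le_max_right _ _) hbt).trans
      ((intervalIntegrable_const (c := F s)).congr_uIoo fun v hv => ?_)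
    rw [uIoo_of_le hbt.le] at hv
    have : R.state v = s := hsub ⟨(le_max_left _ _).trans_lt hv.1, hv.2⟩
    simp only [this]

theorem intervalIntegrable_zero (e : N.Edge) {t : ℝ} (ht : 0 ≤ t) :
    IntervalIntegrable (fun u => ((R.state u).psi e : ℝ)) MeasureTheory.volume 0 t :=
  R.intervalIntegrable_comp (fun s => (s.psi e : ℝ)) ht

theorem intervalIntegrable (e : N.Edge) {s t : ℝ} (hs : 0 ≤ s) (ht : 0 ≤ t) :
    IntervalIntegrable (fun u => ((R.state u).psi e : ℝ)) MeasureTheory.volume s t :=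
  (R.intervalIntegrable_zero e hs).symm.trans (R.intervalIntegrable_zero e ht)

/-- Just after `t` the state is constant, so the arguments of all driving paths are nondecreasing
affine functions of time there, and right-constancy of these paths carries over to the counts. -/
theorem eventually_config_eq (hr : 0 < r) {t : ℝ} (ht : 0 ≤ t) :
    ∀ᶠ u in 𝓝[>] t, R.state u = R.state t ∧ (∀ i, R.A i u = R.A i t) ∧
      ∀ e, R.D e u = R.D e t := by
  refine (R.right t ht).and (Filter.Eventually.and ?_ ?_)
  · rw [eventually_all]
    intro i
    have hl := mul_pos (N.lam_pos i) hr
    filter_upwards [(R.countingA i).eventually_eq (t := t) (mul_nonneg hl.le ht) hl.le] with u hu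
    unfold Realization.A arrivals
    rw [← hu]
    congr 1
    ring
  · rw [eventually_all]
    intro e
    obtain ⟨b, hb, hconst⟩ := R.exists_state_eq_right ht
    have hμ := muE_pos e
    have hnn : 0 ≤ N.muE e * ∫ u in (0 : ℝ)..t, ((R.state u).psi e : ℝ) :=
      mul_nonneg hμ.le (intervalIntegral.integral_nonneg ht fun u _ => Nat.cast_nonneg _)
    filter_upwards [(R.countingS e).eventually_eq (t := t) hnn
      (mul_nonneg hμ.le (Nat.cast_nonneg ((R.state t).psi e))), Ioo_mem_nhdsGT hb] with u hu hub
    unfold Realization.D departures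
    rw [← hu, ← intervalIntegral.integral_add_adjacent_intervals (b := t)
      (R.intervalIntegrable_zero e ht) (R.intervalIntegrable e ht (ht.trans hub.1.le)),
      intervalIntegral.integral_congr_Ioo_of_le (a := t) (b := u)
        (g := fun _ => ((R.state t).psi e : ℝ)) hub.1.le fun v hv => by
          simp only [hconst v hv.1.le (hv.2.trans hub.2)]]
    rw [intervalIntegral.integral_const, smul_eq_mul]
    congr 1
    ring

theorem exists_step_left {t : ℝ} (ht : 0 < t) : ∃ (da : Fin (m + 1) → ℕ) (dd : N.Edge → ℕ),
    ∀ᶠ u in 𝓝[<] t, P.Step r (R.state u) (R.state t) da dd ∧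
      (∀ i, R.A i t = R.A i u + da i) ∧ ∀ e, R.D e t = R.D e u + dd e := by
  obtain ⟨s, a, d, hev, h⟩ := R.event t ht
  rcases h with ⟨ha, hd, hs⟩ | ⟨i, ha, hd, hs⟩ | ⟨e, ha, hd, hs⟩
  · refine ⟨0, 0, hev.mono fun u hu => ⟨Or.inl ⟨rfl, rfl, hs.trans hu.1.symm⟩, fun i => ?_,
      fun e => ?_⟩⟩
    · exact congrFun (ha.trans hu.2.1.symm) i
    · exact congrFun (hd.trans hu.2.2.symm) e
  · refine ⟨Pi.single i 1, 0, hev.mono fun u hu =>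
      ⟨Or.inr (Or.inl ⟨i, rfl, rfl, hu.1 ▸ hs⟩), fun i' => ?_, fun e => ?_⟩⟩
    · have := congrFun ha i'
      rw [← hu.2.1] at this
      exact this
    · exact congrFun (hd.trans hu.2.2.symm) e
  · refine ⟨0, Pi.single e 1, hev.mono fun u hu =>
      ⟨Or.inr (Or.inr ⟨e, rfl, rfl, hu.1 ▸ hs⟩), fun i => ?_, fun e' => ?_⟩⟩
    · exact congrFun (ha.trans hu.2.1.symm) i
    · have := congrFun hd e'
      rw [← hu.2.2] at this
      exact this

/-- Induction over the events of a realization. -/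
theorem event_induction (hr : 0 < r) {p : ℝ → Prop} (h0 : p 0)
    (hstep : ∀ u t, 0 ≤ u → u < t → p u → ∀ da dd, P.Step r (R.state u) (R.state t) da dd →
      (∀ i, R.A i t = R.A i u + da i) → (∀ e, R.D e t = R.D e u + dd e) → p t)
    {t : ℝ} (ht : 0 ≤ t) : p t := by
  refine continuous_induction h0 (fun t ht h => ?_) (fun t ht h => ?_) ht
  · filter_upwards [R.eventually_config_eq hr ht, self_mem_nhdsWithin] with u hu htu
    exact hstep t u ht htu h 0 0 (Or.inl ⟨rfl, rfl, hu.1⟩) hu.2.1 hu.2.2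
  · obtain ⟨da, dd, hev⟩ := R.exists_step_left ht
    obtain ⟨u, hu, hut⟩ := (hev.and (Ioo_mem_nhdsLT ht)).exists
    exact hstep u t hut.1.le hut.2 (h u hut.1.le hut.2) da dd hu.1 hu.2.1 hu.2.2

theorem admissible (hr : 0 < r) {t : ℝ} (ht : 0 ≤ t) : (R.state t).Admissible r :=
  R.event_induction hr (p := fun t => (R.state t).Admissible r) R.initial
    (fun _ _ _ _ h _ _ hs _ _ => hs.admissible h) ht

theorem A_zero (i : Fin (m + 1)) : R.A i 0 = 0 := by
  simp [Realization.A, arrivals, (R.countingA i).zero]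

theorem D_zero (e : N.Edge) : R.D e 0 = 0 := by
  simp [Realization.D, departures, (R.countingS e).zero]

theorem class_balance (hr : 0 < r) {t : ℝ} (ht : 0 ≤ t) (i : Fin (m + 1)) :
    N.classSum (R.state t).psi i + (R.state t).q i + N.classSum (fun e => R.D e t) i =
      N.classSum (R.state 0).psi i + (R.state 0).q i + R.A i t := by
  refine R.event_induction hr (p := fun t => N.classSum (R.state t).psi i + (R.state t).q i +
    N.classSum (fun e => R.D e t) i = N.classSum (R.state 0).psi i + (R.state 0).q i + R.A i t)
    ?_ (fun u t _ _ h da dd hs hA hD => ?_) ht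
  · simp [R.A_zero, R.D_zero, classSum]
  · have h₁ := hs.class_balance i
    have h₂ : N.classSum (fun e => R.D e t) i =
        N.classSum (fun e => R.D e u) i + N.classSum dd i := by
      simp only [hD]
      exact Finset.sum_add_distrib
    rw [h₂, hA]
    omega

/-- While a quantity with upward jumps of size at most one is positive, the content of `(C, B)`
changes only through arrivals and departures. -/
theorem exists_excursion (hr : 0 < r) (C : Finset (Fin (m + 1))) (B : Finset (Fin (n + 1)))
    (g : N.State → ℕ)
    (hg : ∀ s s' da dd, s.Admissible r → P.Step r s s' da dd → g s' ≤ g s + 1)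
    (hbal : ∀ s s' da dd, s.Admissible r → 0 < g s → P.Step r s s' da dd →
      s'.content C B + ∑ j ∈ B, N.poolSum dd j = s.content C B + ∑ i ∈ C, da i)
    {t : ℝ} (ht : 0 ≤ t) (hgt : 0 < g (R.state t)) :
    ∃ s, 0 ≤ s ∧ s ≤ t ∧ 0 < g (R.state s) ∧ (s = 0 ∨ g (R.state s) ≤ 1) ∧
      (R.state t).content C B + ∑ j ∈ B, N.poolSum (fun e => R.D e t) j + ∑ i ∈ C, R.A i s =
      (R.state s).content C B + ∑ j ∈ B, N.poolSum (fun e => R.D e s) j + ∑ i ∈ C, R.A i t := by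
  revert hgt
  refine R.event_induction hr (p := fun t => 0 < g (R.state t) → ∃ s, 0 ≤ s ∧ s ≤ t ∧
    0 < g (R.state s) ∧ (s = 0 ∨ g (R.state s) ≤ 1) ∧
      (R.state t).content C B + ∑ j ∈ B, N.poolSum (fun e => R.D e t) j + ∑ i ∈ C, R.A i s =
      (R.state s).content C B + ∑ j ∈ B, N.poolSum (fun e => R.D e s) j + ∑ i ∈ C, R.A i t)
    (fun h => ⟨0, le_rfl, le_rfl, h, Or.inl rfl, rfl⟩)
    (fun u t hu hut h da dd hs hA hD hgt => ?_) ht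
  have hadm := R.admissible hr hu
  -- If `g` vanishes before the step, a new excursion starts at `t` with value at most one;
  -- otherwise the old starting time is kept and the balance of this step is added.
  rcases Nat.eq_zero_or_pos (g (R.state u)) with h0 | hpos
  · exact ⟨t, hu.trans hut.le, le_rfl, hgt, Or.inr (by simpa [h0] using hg _ _ _ _ hadm hs), rfl⟩
  · obtain ⟨s, hs0, hsu, hgs, hor, hb⟩ := h hpos
    refine ⟨s, hs0, hsu.trans hut.le, hgs, hor, ?_⟩
    have h₁ := hbal _ _ _ _ hadm hpos hs
    have h₂ : ∑ j ∈ B, N.poolSum (fun e => R.D e t) j =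
        ∑ j ∈ B, N.poolSum (fun e => R.D e u) j + ∑ j ∈ B, N.poolSum dd j := by
      simp only [hD]
      rw [← Finset.sum_add_distrib]
      exact Finset.sum_congr rfl fun j _ => Finset.sum_add_distrib
    simp only [hA, Finset.sum_add_distrib, h₂] at *
    omega

end Realization

end Network

/-! ### State space collapse. -/

theorem Finset.sum_le_add_card_mul {ι : Type*} [Fintype ι] (S : Finset ι) {f : ι → ℝ} {x₀ : ι}
    {b : ℝ} (hb : 0 ≤ b) (h0 : 0 ≤ f x₀) (h : ∀ x ∈ S, x ≠ x₀ → f x ≤ b) :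
    ∑ x ∈ S, f x ≤ f x₀ + Fintype.card ι * b := by
  classical
  have hcard : (S.card : ℝ) * b ≤ Fintype.card ι * b :=
    mul_le_mul_of_nonneg_right (by exact_mod_cast S.card_le_univ) hb
  calc ∑ x ∈ S, f x ≤ ∑ x ∈ S, ((if x₀ = x then f x₀ else 0) + b) := by
        refine Finset.sum_le_sum fun x hx => ?_
        split_ifs with hx0
        · rw [← hx0]; linarith
        · simpa using h x hx fun h => hx0 h.symm
    _ ≤ f x₀ + Fintype.card ι * b := by
        rw [Finset.sum_add_distrib, Finset.sum_ite_eq, Finset.sum_const, nsmul_eq_mul]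
        split_ifs <;> linarith

namespace Network

variable {m n : ℕ} {N : Network m n} {P : N.Priority} {r : ℝ}

/-- The classes whose customers compete, directly or through a chain of activities whose priority
is at least that of `e`, for the servers of the pool of `e`, with priority at least that of the
class of `e`. -/
inductive Priority.Upstream (P : N.Priority) (e : N.Edge) : Fin (m + 1) → Prop
  | root (e' : N.Edge) : e'.1.2 = e.1.2 → e'.1.1 ≤ e.1.1 → Upstream P e e'.1.1
  | step (e' e'' : N.Edge) : Upstream P e e'.1.1 → ¬ P.IsLast e' → P.prio e' ≤ P.prio e →
      e''.1.2 = e'.1.2 → Upstream P e e''.1.1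

/-- The pools that serve upstream classes, together with the pool of `e`. -/
def Priority.UpstreamPool (P : N.Priority) (e : N.Edge) (j : Fin (n + 1)) : Prop :=
  j = e.1.2 ∨ ∃ e', ¬ P.IsLast e' ∧ P.Upstream e e'.1.1 ∧ P.prio e' ≤ P.prio e ∧ e'.1.2 = j

namespace Priority

variable {e : N.Edge}

theorem upstream_self (P : N.Priority) (e : N.Edge) : P.Upstream e e.1.1 := .root e rfl le_rfl

theorem Upstream.le {i : Fin (m + 1)} (h : P.Upstream e i) : i ≤ e.1.1 := by
  induction h with
  | root e' _ h => exact h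
  | step e' e'' _ hl _ hp ih => exact (class_le_of_not_isLast hl e'' hp).trans ih

/-- Upstream sets are closed under passing from pools to classes, except for the classes that rank
below `e` in its own pool. -/
theorem UpstreamPool.upstream_or {e' : N.Edge} (h : P.UpstreamPool e e'.1.2) :
    P.Upstream e e'.1.1 ∨ (e'.1.2 = e.1.2 ∧ e.1.1 < e'.1.1) := by
  rcases h with h | ⟨e'', hl, hup, hle, hp⟩
  · rcases le_or_gt e'.1.1 e.1.1 with h' | h'
    · exact Or.inl (.root e' h h')
    · exact Or.inr ⟨h, h'⟩
  · exact Or.inl (.step e'' e' hup hl hle hp.symm)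

/-- A class other than that of `e` becomes upstream through one of its activities. If this is its
last activity, its pool is upstream. If not, at a root the class must be that of `e`, and at a chain
step the activity is the non-last one already used, so nothing new was added. -/
theorem Upstream.eq_or_upstreamPool {i : Fin (m + 1)} (h : P.Upstream e i) :
    i = e.1.1 ∨ ∀ l, P.IsLast l → l.1.1 = i → P.UpstreamPool e l.1.2 := by
  induction h with
  | root e' hp hle =>
    by_cases hl : P.IsLast e'
    · exact Or.inr fun l hl' hc => Or.inl (by rw [hl'.eq hl hc, hp])
    · exact Or.inl (le_antisymm hle (class_le_of_not_isLast hl e hp.symm))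
  | step e' e'' hup hl hle hp ih =>
    by_cases hl'' : P.IsLast e''
    · exact Or.inr fun l hl' hc => Or.inr ⟨e', hl, hup, hle, by rw [hl'.eq hl'' hc, hp]⟩
    · rw [eq_of_not_isLast hl'' hl hp]
      exact ih

/-- The dual closure, from classes to pools, fails only for activities of the class of `e` that rank
below `e`. A non-last activity ranking below `e` belongs to a class numbered at least that of `e`,
and upstream classes never exceed that number. -/
theorem Upstream.upstreamPool_or {e' : N.Edge} (h : P.Upstream e e'.1.1) :
    P.UpstreamPool e e'.1.2 ∨ (e'.1.1 = e.1.1 ∧ P.prio e < P.prio e') := by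
  by_contra! hcon
  obtain ⟨hpool, hprio⟩ := hcon
  by_cases hl : P.IsLast e'
  · rcases h.eq_or_upstreamPool with hc | hc
    · have hle := hprio hc
      exact hpool (Or.inl (by rw [P.injective (le_antisymm hle (hl e hc.symm))]))
    · exact hpool (hc e' hl rfl)
  · by_cases hle : P.prio e' ≤ P.prio e
    · exact hpool (Or.inr ⟨e', hl, h, hle, rfl⟩)
    · exact hle (hprio (le_antisymm h.le (P.smallest_class _ _ (not_le.1 hle).le)))

theorem UpstreamPool.exists_prio_lt {j : Fin (n + 1)} (h : P.UpstreamPool e j) (hj : j ≠ e.1.2) :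
    ∃ e', ¬ P.IsLast e' ∧ P.prio e' < P.prio e ∧ e'.1.2 = j := by
  rcases h with h | ⟨e', hl, -, hle, hp⟩
  · exact absurd h hj
  · refine ⟨e', hl, lt_of_le_of_ne hle fun h => hj ?_, hp⟩
    rw [← hp, P.injective h]

/-- One of the two exceptions always disappears: a non-last `e` has no class below it in its pool,
and a last `e` has no activity below it in its class. -/
theorem UpstreamPool.upstream_of_not_isLast (he : ¬ P.IsLast e) {e' : N.Edge}
    (h : P.UpstreamPool e e'.1.2) : P.Upstream e e'.1.1 :=
  h.upstream_or.resolve_right fun h' =>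
    absurd (class_le_of_not_isLast he e' h'.1) (not_le.2 h'.2)

theorem Upstream.upstreamPool_of_isLast (he : P.IsLast e) {e' : N.Edge}
    (h : P.Upstream e e'.1.1) : P.UpstreamPool e e'.1.2 :=
  h.upstreamPool_or.resolve_right fun h' => absurd (he e' h'.1) (not_le.2 h'.2)

theorem not_upstreamPool_of_isLast (he : ¬ P.IsLast e) {l : N.Edge} (hl : P.IsLast l)
    (hc : l.1.1 = e.1.1) : ¬ P.UpstreamPool e l.1.2 := by
  rintro (h | ⟨e', hl', hup, -, hp⟩)
  · exact he (edge_ext hc h ▸ hl)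
  · have : l = e' := edge_ext
      (le_antisymm (class_le_of_not_isLast hl' l hp.symm) (hc ▸ hup.le)) hp.symm
    exact hl' (this ▸ hl)

theorem not_upstream_of_not_isLast (he : P.IsLast e) {e' : N.Edge} (he' : ¬ P.IsLast e')
    (hp : e'.1.2 = e.1.2) : ¬ P.Upstream e e'.1.1 := by
  intro h
  have : e' = e := edge_ext (le_antisymm h.le (class_le_of_not_isLast he' e hp.symm)) hp
  exact he' (this ▸ he)

open Classical in
/-- The finset of upstream classes. -/
noncomputable def upClasses (P : N.Priority) (e : N.Edge) : Finset (Fin (m + 1)) :=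
  Finset.univ.filter (P.Upstream e)

open Classical in
/-- The finset of upstream pools. -/
noncomputable def upPools (P : N.Priority) (e : N.Edge) : Finset (Fin (n + 1)) :=
  Finset.univ.filter (P.UpstreamPool e)

theorem mem_upClasses {i : Fin (m + 1)} : i ∈ P.upClasses e ↔ P.Upstream e i := by
  simp [upClasses]

theorem mem_upPools {j : Fin (n + 1)} : j ∈ P.upPools e ↔ P.UpstreamPool e j := by
  simp [upPools]

end Priority

/-- The number of idle servers. -/
noncomputable def State.idle (s : N.State) (r : ℝ) (j : Fin (n + 1)) : ℕ :=
  N.servers r j - N.poolSum s.psi j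

theorem State.Admissible.idle_eq {s : N.State} (h : s.Admissible r) (j : Fin (n + 1)) :
    (s.idle r j : ℝ) = N.servers r j - N.poolSum s.psi j := by
  rw [State.idle, Nat.cast_sub (h.1 j)]

theorem State.hasIdle_of_idle_pos {s : N.State} {j : Fin (n + 1)} (h : 0 < s.idle r j) :
    s.HasIdle r j :=
  Nat.lt_of_sub_pos h

theorem State.Admissible.q_eq_zero {s : N.State} (h : s.Admissible r) {e : N.Edge}
    (hi : s.HasIdle r e.1.2) : s.q e.1.1 = 0 := by
  by_contra hq
  exact absurd (h.2 e (Nat.pos_of_ne_zero hq)) hi.ne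

theorem State.Admissible.idle_eq_zero {s : N.State} (h : s.Admissible r) {e : N.Edge}
    (hq : 0 < s.q e.1.1) : s.idle r e.1.2 = 0 := by
  rw [State.idle, h.2 e hq, Nat.sub_self]

/-- The exceptional activities are dormant: while the pool of `e` has an idle server, arrivals of
the class of `e` never go to an activity below `e`, and none of its customers wait to be taken
elsewhere. -/
theorem Priority.Step.content_balance_of_idle_pos {s s' : N.State} {da : Fin (m + 1) → ℕ}
    {dd : N.Edge → ℕ} (h : P.Step r s s' da dd) (hs : s.Admissible r) {e : N.Edge}
    (he : ¬ P.IsLast e) (hidle : 0 < s.idle r e.1.2) :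
    s'.content (P.upClasses e) (P.upPools e) + ∑ j ∈ P.upPools e, N.poolSum dd j =
      s.content (P.upClasses e) (P.upPools e) + ∑ i ∈ P.upClasses e, da i := by
  have hidle := State.hasIdle_of_idle_pos hidle
  refine h.content_balance _ _ (fun e' _ hmin => ?_) (fun e' hq _ => ?_) <;>
    rw [Priority.mem_upClasses, Priority.mem_upPools]
  · refine ⟨fun hup => hup.upstreamPool_or.resolve_right fun h' => ?_,
      fun h => h.upstream_of_not_isLast he⟩
    exact absurd (hmin e h'.1.symm hidle) (not_le.2 h'.2)
  · refine ⟨fun hup => hup.upstreamPool_or.resolve_right fun h' => ?_,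
      fun h => h.upstream_of_not_isLast he⟩
    rw [h'.1] at hq
    exact hq.ne' (hs.q_eq_zero hidle)

/-- While the class of `e` has a queue, the pool of `e` is full and admits no arrivals, and its
freed servers prefer this class to every larger-numbered one. -/
theorem Priority.Step.content_balance_of_q_pos {s s' : N.State} {da : Fin (m + 1) → ℕ}
    {dd : N.Edge → ℕ} (h : P.Step r s s' da dd) (hs : s.Admissible r) {e : N.Edge}
    (he : P.IsLast e) (hq : 0 < s.q e.1.1) :
    s'.content (P.upClasses e) (P.upPools e) + ∑ j ∈ P.upPools e, N.poolSum dd j =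
      s.content (P.upClasses e) (P.upPools e) + ∑ i ∈ P.upClasses e, da i := by
  refine h.content_balance _ _ (fun e' hidle _ => ?_) (fun e' _ hmin => ?_) <;>
    rw [Priority.mem_upClasses, Priority.mem_upPools]
  · refine ⟨fun hup => hup.upstreamPool_of_isLast he,
      fun hp => hp.upstream_or.resolve_right fun h' => ?_⟩
    have := hs.2 e hq
    rw [← h'.1] at this
    exact absurd this hidle.ne
  · refine ⟨fun hup => hup.upstreamPool_of_isLast he,
      fun hp => hp.upstream_or.resolve_right fun h' => ?_⟩
    exact absurd (hmin e h'.1.symm hq) (not_le.2 h'.2)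

theorem sum_poolSum {M : Type*} [AddCommMonoid M] (B : Finset (Fin (n + 1))) (f : N.Edge → M) :
    ∑ j ∈ B, N.poolSum f j = ∑ e : N.Edge with e.1.2 ∈ B, f e := by
  simp only [poolSum, Finset.sum_filter]
  rw [Finset.sum_comm]
  exact Finset.sum_congr rfl fun e _ => Finset.sum_ite_eq B _ _

theorem sum_classSum {M : Type*} [AddCommMonoid M] (C : Finset (Fin (m + 1))) (f : N.Edge → M) :
    ∑ i ∈ C, N.classSum f i = ∑ e : N.Edge with e.1.1 ∈ C, f e := by
  simp only [classSum, Finset.sum_filter]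
  rw [Finset.sum_comm]
  exact Finset.sum_congr rfl fun e _ => Finset.sum_ite_eq C _ _

/-- A realization whose driving processes are within `a` of their means on `[0, T]`, which starts
within `a` of a state with full pools (but the last one) and empty queues, whose occupancies remain
within `δ r` of the equilibrium, and whose last pool does not fill up. -/
structure Realization.Tame (R : Realization P r) (δ a T : ℝ) : Prop where
  arrival : ∀ i t, 0 ≤ t → t ≤ T → |(R.A i t : ℝ) - N.lam i * r * t| ≤ a
  departure : ∀ e t, 0 ≤ t → t ≤ T →
    |(R.D e t : ℝ) - N.muE e * ∫ s in (0 : ℝ)..t, ((R.state s).psi e : ℝ)| ≤ a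
  near : ∀ e t, 0 ≤ t → t ≤ T → |((R.state t).psi e : ℝ) - r * P.psiStar e| ≤ δ * r
  not_full : ∀ t, 0 ≤ t → t ≤ T → (R.state t).HasIdle r (Fin.last n)
  one_le : 1 ≤ a
  init_q : ∀ i, ((R.state 0).q i : ℝ) ≤ a
  init_idle : ∀ j, j ≠ Fin.last n → ((R.state 0).idle r j : ℝ) ≤ a

namespace Realization.Tame

variable {R : Realization P r} {δ a T : ℝ}

theorem arrivals_le (h : R.Tame δ a T) (C : Finset (Fin (m + 1))) {s t : ℝ} (hs : 0 ≤ s)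
    (hst : s ≤ t) (ht : t ≤ T) :
    |((∑ i ∈ C, R.A i t : ℕ) : ℝ) - (∑ i ∈ C, R.A i s : ℕ) - (∑ i ∈ C, N.lam i) * r * (t - s)| ≤
      2 * (m + 1) * a := by
  have ha : 0 ≤ a := zero_le_one.trans h.one_le
  have heq : ((∑ i ∈ C, R.A i t : ℕ) : ℝ) - (∑ i ∈ C, R.A i s : ℕ) -
      (∑ i ∈ C, N.lam i) * r * (t - s) =
      ∑ i ∈ C, ((R.A i t - N.lam i * r * t) - (R.A i s - N.lam i * r * s)) := by
    push_cast
    simp only [Finset.sum_sub_distrib, mul_assoc, ← Finset.sum_mul]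
    ring
  rw [heq]
  refine (Finset.abs_sum_le_sum_abs _ _).trans ?_
  refine (Finset.sum_le_card_nsmul _ _ (2 * a) fun i _ => (abs_sub _ _).trans ?_).trans ?_
  · linarith [h.arrival i t (hs.trans hst) ht, h.arrival i s hs (hst.trans ht)]
  · rw [nsmul_eq_mul]
    have : (C.card : ℝ) ≤ m + 1 := by
      have := C.card_le_univ
      rw [Fintype.card_fin] at this
      exact_mod_cast this
    nlinarith

/-- Each activity contributes two endpoint errors `a`. Occupancies off equilibrium by at most `δ r`
add an error of drift type, which must later be absorbed by the equilibrium surplus `κ`. -/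
theorem departures_le (h : R.Tame δ a T) (B : Finset (Fin (n + 1))) {s t : ℝ} (hs : 0 ≤ s)
    (hst : s ≤ t) (ht : t ≤ T) :
    |((∑ j ∈ B, N.poolSum (fun e => R.D e t) j : ℕ) : ℝ) -
        (∑ j ∈ B, N.poolSum (fun e => R.D e s) j : ℕ) -
        (∑ j ∈ B, N.poolSum (fun e => N.muE e * P.psiStar e) j) * r * (t - s)| ≤
      2 * Fintype.card N.Edge * a + δ * (∑ e : N.Edge, N.muE e) * r * (t - s) := by
  have ha : 0 ≤ a := zero_le_one.trans h.one_le
  simp only [sum_poolSum]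
  push_cast
  rw [Finset.sum_mul, Finset.sum_mul, ← Finset.sum_sub_distrib, ← Finset.sum_sub_distrib]
  refine (Finset.abs_sum_le_sum_abs _ _).trans ?_
  have hterm : ∀ e : N.Edge, |(R.D e t : ℝ) - R.D e s - N.muE e * P.psiStar e * r * (t - s)| ≤
      2 * a + δ * N.muE e * r * (t - s) := by
    intro e
    have hint := intervalIntegral.integral_add_adjacent_intervals
      (R.intervalIntegrable_zero e hs) (R.intervalIntegrable e hs (hs.trans hst))
    have hdev : |∫ u in s..t, (((R.state u).psi e : ℝ) - r * P.psiStar e)| ≤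
        δ * r * |t - s| :=
      intervalIntegral.norm_integral_le_of_norm_le_const (C := δ * r)
        (f := fun u => ((R.state u).psi e : ℝ) - r * P.psiStar e) fun u hu => by
        rw [uIoc_of_le hst] at hu
        exact h.near e u (hs.trans hu.1.le) (hu.2.trans ht)
    rw [intervalIntegral.integral_sub (R.intervalIntegrable e hs (hs.trans hst))
      intervalIntegrable_const, intervalIntegral.integral_const, smul_eq_mul,
      abs_of_nonneg (sub_nonneg.2 hst)] at hdev
    have h₁ := h.departure e t (hs.trans hst) ht
    have h₂ := h.departure e s hs (hst.trans ht)
    have hμ := muE_pos e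
    rw [← hint] at h₁
    have h₃ := mul_le_mul_of_nonneg_left hdev hμ.le
    rw [← abs_of_pos hμ, ← abs_mul, abs_of_pos hμ] at h₃
    rw [abs_le] at *
    constructor <;> nlinarith
  have hnn : ∀ e : N.Edge, 0 ≤ 2 * a + δ * N.muE e * r * (t - s) := fun e =>
    (abs_nonneg _).trans (hterm e)
  calc _ ≤ ∑ e : N.Edge with e.1.2 ∈ B, (2 * a + δ * N.muE e * r * (t - s)) :=
        Finset.sum_le_sum fun e _ => hterm e
    _ ≤ ∑ e : N.Edge, (2 * a + δ * N.muE e * r * (t - s)) :=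
        Finset.sum_le_univ_sum_of_nonneg hnn
    _ = _ := by
        rw [Finset.sum_add_distrib, Finset.sum_const, Finset.card_univ, nsmul_eq_mul,
          Finset.mul_sum, Finset.sum_mul, Finset.sum_mul]
        ring

theorem idle_le_of (h : R.Tame δ a T) {s : ℝ} {j : Fin (n + 1)} (hj : j ≠ Fin.last n)
    (hs : s = 0 ∨ (R.state s).idle r j ≤ 1) : ((R.state s).idle r j : ℝ) ≤ a := by
  rcases hs with rfl | hs
  · exact h.init_idle j hj
  · exact le_trans (by exact_mod_cast hs) h.one_le

theorem q_le_of (h : R.Tame δ a T) {s : ℝ} {i : Fin (m + 1)}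
    (hs : s = 0 ∨ (R.state s).q i ≤ 1) : ((R.state s).q i : ℝ) ≤ a := by
  rcases hs with rfl | hs
  · exact h.init_q i
  · exact le_trans (by exact_mod_cast hs) h.one_le

end Realization.Tame

theorem State.Admissible.content_eq {s : N.State} (h : s.Admissible r)
    (C : Finset (Fin (m + 1))) (B : Finset (Fin (n + 1))) :
    (s.content C B : ℝ) =
      ∑ i ∈ C, (s.q i : ℝ) + ∑ j ∈ B, (N.servers r j : ℝ) - ∑ j ∈ B, (s.idle r j : ℝ) := by
  simp only [h.idle_eq, Finset.sum_sub_distrib, State.content]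
  push_cast
  ring

section Drift

variable {κ : ℝ}

/-- All activities of upstream pools belong to upstream classes, and so does the last activity of
the class of `e`, whose pool is not upstream. Its equilibrium rate is the surplus of arrivals over
departures. -/
theorem Priority.drift_of_not_isLast
    (hbal : ∀ i, N.classSum (fun e => N.muE e * P.psiStar e) i = N.lam i)
    (h0 : 0 ≤ κ) (hκ : ∀ e, κ ≤ N.muE e * P.psiStar e) {e : N.Edge} (he : ¬ P.IsLast e) :
    ∑ j ∈ P.upPools e, N.poolSum (fun e => N.muE e * P.psiStar e) j + κ ≤
      ∑ i ∈ P.upClasses e, N.lam i := by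
  obtain ⟨l, hl, hc⟩ := P.exists_isLast e.1.1
  simp only [← hbal]
  rw [sum_poolSum, sum_classSum]
  have hnot : l ∉ Finset.univ.filter fun e' : N.Edge => e'.1.2 ∈ P.upPools e := by
    simpa [Priority.mem_upPools] using not_upstreamPool_of_isLast he hl hc
  calc _ ≤ ∑ e' ∈ insert l (Finset.univ.filter fun e' : N.Edge => e'.1.2 ∈ P.upPools e),
          N.muE e' * P.psiStar e' := by
        rw [Finset.sum_insert hnot]
        linarith [hκ l]
    _ ≤ _ := by
        refine Finset.sum_le_sum_of_subset_of_nonneg (fun e' he' => ?_)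
          fun e' _ _ => h0.trans (hκ e')
        rw [Finset.mem_insert, Finset.mem_filter] at he'
        rw [Finset.mem_filter, mem_upClasses]
        refine ⟨Finset.mem_univ _, ?_⟩
        rcases he' with rfl | ⟨-, he'⟩
        · exact hc ▸ P.upstream_self e
        · exact (mem_upPools.1 he').upstream_of_not_isLast he

/-- Here the surplus of service capacity is the rate of the non-last activity in the pool of `e`,
whose class is not upstream. Pool J has no such activity. -/
theorem Priority.drift_of_isLast
    (hbal : ∀ i, N.classSum (fun e => N.muE e * P.psiStar e) i = N.lam i)
    (h0 : 0 ≤ κ) (hκ : ∀ e, κ ≤ N.muE e * P.psiStar e) {e : N.Edge} (he : P.IsLast e)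
    (hJ : e.1.2 ≠ Fin.last n) :
    ∑ i ∈ P.upClasses e, N.lam i + κ ≤
      ∑ j ∈ P.upPools e, N.poolSum (fun e => N.muE e * P.psiStar e) j := by
  obtain ⟨l, hl, hp⟩ := P.exists_not_isLast hJ
  simp only [← hbal]
  rw [sum_poolSum, sum_classSum]
  have hnot : l ∉ Finset.univ.filter fun e' : N.Edge => e'.1.1 ∈ P.upClasses e := by
    simpa [Priority.mem_upClasses] using not_upstream_of_not_isLast he hl hp
  calc _ ≤ ∑ e' ∈ insert l (Finset.univ.filter fun e' : N.Edge => e'.1.1 ∈ P.upClasses e),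
          N.muE e' * P.psiStar e' := by
        rw [Finset.sum_insert hnot]
        linarith [hκ l]
    _ ≤ _ := by
        refine Finset.sum_le_sum_of_subset_of_nonneg (fun e' he' => ?_)
          fun e' _ _ => h0.trans (hκ e')
        rw [Finset.mem_insert, Finset.mem_filter] at he'
        rw [Finset.mem_filter, mem_upPools]
        refine ⟨Finset.mem_univ _, ?_⟩
        rcases he' with rfl | ⟨-, he'⟩
        · exact Or.inl hp
        · exact (mem_upClasses.1 he').upstreamPool_of_isLast he

end Drift

/-- State space collapse: the queues and the numbers of idle servers (in all pools but the last
one) remain within a multiple of the error `a`. -/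
theorem Priority.exists_collapse_edge {κ δ : ℝ}
    (hbal : ∀ i, N.classSum (fun e => N.muE e * P.psiStar e) i = N.lam i)
    (h0 : 0 ≤ κ) (hκ : ∀ e, κ ≤ N.muE e * P.psiStar e)
    (hδ : δ * ∑ e : N.Edge, N.muE e ≤ κ) (e : N.Edge) :
    ∃ K : ℝ, 0 ≤ K ∧ ∀ (r : ℝ) (R : Realization P r) (a T : ℝ), 0 < r → R.Tame δ a T →
      ∀ t, 0 ≤ t → t ≤ T → (P.IsLast e → ((R.state t).q e.1.1 : ℝ) ≤ K * a) ∧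
        (¬ P.IsLast e → ((R.state t).idle r e.1.2 : ℝ) ≤ K * a) := by
  induction e using P.induction with
  | step e ih =>
    choose! K hK0 hK using ih
    let S := Finset.univ.filter fun e' : N.Edge => P.prio e' < P.prio e
    have hS : ∀ e' ∈ S, P.prio e' < P.prio e := fun e' h => (Finset.mem_filter.1 h).2
    set M := ∑ e' ∈ S, K e' with hMdef
    have hM0 : 0 ≤ M := Finset.sum_nonneg fun e' h => hK0 e' (hS e' h)
    have hKM : ∀ e', P.prio e' < P.prio e → K e' ≤ M := fun e' h =>
      Finset.single_le_sum (f := K) (fun e' h => hK0 e' (hS e' h)) (by simpa [S] using h)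
    -- The terms with `M` bound the queues and idle servers of the other upstream classes and pools,
    -- `1` is for the quantity itself at the start of the excursion, and the rest are the arrival
    -- and departure errors.
    refine ⟨(m + 1) * M + (n + 1) * M + 1 + 2 * (m + 1) + 2 * Fintype.card N.Edge, by positivity,
      fun r R a T hr hR t ht htT => ?_⟩
    have ha : 0 ≤ a := zero_le_one.trans hR.one_le
    have hMa : 0 ≤ M * a := mul_nonneg hM0 ha
    -- Other upstream classes have smaller numbers, so their last activities precede `e` and the
    -- induction hypothesis applies.
    have hq : ∀ i ∈ P.upClasses e, i ≠ e.1.1 → ∀ t, 0 ≤ t → t ≤ T →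
        ((R.state t).q i : ℝ) ≤ M * a := by
      intro i hi hne t ht htT
      obtain ⟨l, hl, rfl⟩ := P.exists_isLast i
      have hlt := prio_lt_of_class_lt (P := P)
        (lt_of_le_of_ne (mem_upClasses.1 hi).le hne)
      exact ((hK l hlt r R a T hr hR t ht htT).1 hl).trans
        (mul_le_mul_of_nonneg_right (hKM l hlt) ha)
    have hidle : ∀ j ∈ P.upPools e, j ≠ e.1.2 → ∀ t, 0 ≤ t → t ≤ T →
        ((R.state t).idle r j : ℝ) ≤ M * a := by
      intro j hj hne t ht htT
      obtain ⟨l, hl, hlt, rfl⟩ := (mem_upPools.1 hj).exists_prio_lt hne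
      exact ((hK l hlt r R a T hr hR t ht htT).2 hl).trans
        (mul_le_mul_of_nonneg_right (hKM l hlt) ha)
    have hfinal : (1 + ((m + 1) * (M * a) + (n + 1) * (M * a) + 2 * (m + 1) * a +
        2 * Fintype.card N.Edge * a) - 1) + a =
        ((m + 1) * M + (n + 1) * M + 1 + 2 * (m + 1) + 2 * Fintype.card N.Edge) * a := by ring
    have hKa : 0 ≤ ((m + 1) * M + (n + 1) * M + 1 + 2 * (m + 1) +
        2 * Fintype.card N.Edge) * a := by positivity
    have hadm : ∀ {t}, 0 ≤ t → (R.state t).Admissible r := fun ht => R.admissible hr ht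
    constructor
    · intro he
      rcases Nat.eq_zero_or_pos ((R.state t).q e.1.1) with hz | hpos
      · rw [hz, Nat.cast_zero]
        exact hKa
      -- A class served by pool J has no queue, since that pool always has an idle server.
      have hJ : e.1.2 ≠ Fin.last n := fun hJ => by
        have h₁ := hR.not_full t ht htT
        rw [← hJ] at h₁
        exact hpos.ne' ((hadm ht).q_eq_zero h₁)
      -- At the start `s` of the current busy excursion the queue is at most `a`; from then on only
      -- arrivals and departures change the upstream content, and the drift is downward.
      obtain ⟨s, hs0, hst, -, hs, hb⟩ := R.exists_excursion hr (P.upClasses e) (P.upPools e)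
        (fun s => s.q e.1.1) (fun s s' da dd _ h => h.q_le _)
        (fun s s' da dd hs hg h => h.content_balance_of_q_pos hs he hg) ht hpos
      have hsT := hst.trans htT
      have h₁ := abs_le.1 (hR.arrivals_le (P.upClasses e) hs0 hst htT)
      have h₂ := abs_le.1 (hR.departures_le (P.upPools e) hs0 hst htT)
      have hb' := congrArg (Nat.cast (R := ℝ)) hb
      simp only [Nat.cast_add] at hb'
      rw [(hadm ht).content_eq, (hadm hs0).content_eq] at hb'
      have hdrift := drift_of_isLast hbal h0 hκ he hJ
      have h₃ := Finset.sum_le_add_card_mul (P.upClasses e)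
        (f := fun i => ((R.state s).q i : ℝ)) (x₀ := e.1.1) hMa (Nat.cast_nonneg _)
        fun i hi hne => hq i hi hne s hs0 hsT
      have h₄ := Finset.sum_le_add_card_mul (P.upPools e)
        (f := fun j => ((R.state t).idle r j : ℝ)) (x₀ := e.1.2) hMa (Nat.cast_nonneg _)
        fun j hj hne => hidle j hj hne t ht htT
      rw [(hadm ht).idle_eq_zero hpos, Nat.cast_zero] at h₄
      have h₅ : ((R.state t).q e.1.1 : ℝ) ≤ ∑ i ∈ P.upClasses e, ((R.state t).q i : ℝ) :=
        Finset.single_le_sum (f := fun i => ((R.state t).q i : ℝ)) (fun i _ => Nat.cast_nonneg _)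
          (mem_upClasses.2 (P.upstream_self e))
      have h₆ : 0 ≤ ∑ j ∈ P.upPools e, ((R.state s).idle r j : ℝ) :=
        Finset.sum_nonneg fun j _ => Nat.cast_nonneg _
      have h₇ := hR.q_le_of hs
      have hrt : 0 ≤ r * (t - s) := mul_nonneg hr.le (sub_nonneg.2 hst)
      -- The surplus `κ` dominates the drift error, so the terms proportional to `r * (t - s)` have
      -- a favourable sign and the bound does not depend on the length of the excursion.
      have h₈ := mul_le_mul_of_nonneg_right (hdrift.trans' (add_le_add_right hδ _)) hrt
      rw [Fintype.card_fin] at h₃ h₄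
      push_cast at h₃ h₄ h₁ h₂ hb'
      linarith
    · intro he
      rcases Nat.eq_zero_or_pos ((R.state t).idle r e.1.2) with hz | hpos
      · rw [hz, Nat.cast_zero]
        exact hKa
      have hJ := pool_ne_last_of_not_isLast he
      -- The mirror image: during an excursion of idleness the upstream content drifts upward, so
      -- the idle servers cannot accumulate.
      obtain ⟨s, hs0, hst, -, hs, hb⟩ := R.exists_excursion hr (P.upClasses e) (P.upPools e)
        (fun s => s.idle r e.1.2) (fun s s' da dd _ h => by
          have := h.poolSum_le e.1.2
          unfold State.idle
          omega)
        (fun s s' da dd hs hg h => h.content_balance_of_idle_pos hs he hg) ht hpos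
      have hsT := hst.trans htT
      have h₁ := abs_le.1 (hR.arrivals_le (P.upClasses e) hs0 hst htT)
      have h₂ := abs_le.1 (hR.departures_le (P.upPools e) hs0 hst htT)
      have hb' := congrArg (Nat.cast (R := ℝ)) hb
      simp only [Nat.cast_add] at hb'
      rw [(hadm ht).content_eq, (hadm hs0).content_eq] at hb'
      have hdrift := drift_of_not_isLast hbal h0 hκ he
      have h₃ := Finset.sum_le_add_card_mul (P.upClasses e)
        (f := fun i => ((R.state t).q i : ℝ)) (x₀ := e.1.1) hMa (Nat.cast_nonneg _)
        fun i hi hne => hq i hi hne t ht htT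
      have h₄ := Finset.sum_le_add_card_mul (P.upPools e)
        (f := fun j => ((R.state s).idle r j : ℝ)) (x₀ := e.1.2) hMa (Nat.cast_nonneg _)
        fun j hj hne => hidle j hj hne s hs0 hsT
      rw [(hadm ht).q_eq_zero (State.hasIdle_of_idle_pos hpos), Nat.cast_zero] at h₃
      have h₅ : ((R.state t).idle r e.1.2 : ℝ) ≤
          ∑ j ∈ P.upPools e, ((R.state t).idle r j : ℝ) :=
        Finset.single_le_sum (f := fun j => ((R.state t).idle r j : ℝ))
          (fun i _ => Nat.cast_nonneg _) (mem_upPools.2 (Or.inl rfl))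
      have h₆ : 0 ≤ ∑ i ∈ P.upClasses e, ((R.state s).q i : ℝ) :=
        Finset.sum_nonneg fun i _ => Nat.cast_nonneg _
      have h₇ := hR.idle_le_of hJ hs
      have hrt : 0 ≤ r * (t - s) := mul_nonneg hr.le (sub_nonneg.2 hst)
      have h₈ := mul_le_mul_of_nonneg_right (hdrift.trans' (add_le_add_right hδ _)) hrt
      rw [Fintype.card_fin] at h₃ h₄
      push_cast at h₃ h₄ h₁ h₂ hb'
      linarith

theorem Priority.exists_collapse {κ δ : ℝ}
    (hbal : ∀ i, N.classSum (fun e => N.muE e * P.psiStar e) i = N.lam i)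
    (h0 : 0 ≤ κ) (hκ : ∀ e, κ ≤ N.muE e * P.psiStar e)
    (hδ : δ * ∑ e : N.Edge, N.muE e ≤ κ) :
    ∃ K : ℝ, 0 ≤ K ∧ ∀ (r : ℝ) (R : Realization P r) (a T : ℝ), 0 < r → R.Tame δ a T →
      ∀ t, 0 ≤ t → t ≤ T → (∀ i, ((R.state t).q i : ℝ) ≤ K * a) ∧
        ∀ j, j ≠ Fin.last n → ((R.state t).idle r j : ℝ) ≤ K * a := by
  choose K hK0 hK using exists_collapse_edge hbal h0 hκ hδ
  have hle : ∀ e, K e ≤ ∑ e, K e := fun e =>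
    Finset.single_le_sum (f := K) (fun e _ => hK0 e) (Finset.mem_univ e)
  refine ⟨∑ e, K e, Finset.sum_nonneg fun e _ => hK0 e, fun r R a T hr hR t ht htT =>
    ⟨fun i => ?_, fun j hj => ?_⟩⟩
  · obtain ⟨e, he, rfl⟩ := P.exists_isLast i
    exact ((hK e r R a T hr hR t ht htT).1 he).trans
      (mul_le_mul_of_nonneg_right (hle e) (zero_le_one.trans hR.one_le))
  · obtain ⟨e, he, rfl⟩ := P.exists_not_isLast hj
    exact ((hK e r R a T hr hR t ht htT).2 he).trans
      (mul_le_mul_of_nonneg_right (hle e) (zero_le_one.trans hR.one_le))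

end Network

/-! ### Tracking of fluid models by realizations. -/

/-- Grönwall's inequality in integral form, for right-continuous functions. -/
theorem le_mul_exp_of_le_integral {w : ℝ → ℝ} {b K T : ℝ} (hK : 0 < K)
    (hint : ∀ t, 0 ≤ t → t ≤ T → IntervalIntegrable w MeasureTheory.volume 0 t)
    (hright : ∀ t, 0 ≤ t → t < T → ContinuousWithinAt w (Ioi t) t)
    (hw : ∀ t, 0 ≤ t → t ≤ T → w t ≤ K * (b + ∫ s in (0 : ℝ)..t, w s)) {t : ℝ} (ht : 0 ≤ t)
    (htT : t ≤ T) : w t ≤ K * b * Real.exp (K * t) := by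
  have hT : 0 ≤ T := ht.trans htT
  have hderiv : ∀ x ∈ Ico 0 T, HasDerivWithinAt (fun u => ∫ s in (0 : ℝ)..u, w s) (w x)
      (Ici x) x := fun x hx =>
    intervalIntegral.integral_hasDerivWithinAt_right (hint x hx.1 hx.2.le)
      ⟨Ioc 0 T, mem_of_superset (Ioo_mem_nhdsGT hx.2) fun u hu =>
        ⟨hx.1.trans_lt hu.1, hu.2.le⟩, (hint T hT le_rfl).1.aestronglyMeasurable⟩
      (hright x hx.1 hx.2)
  have hcont : ContinuousOn (fun u => ∫ s in (0 : ℝ)..u, w s) (Icc 0 T) :=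
    intervalIntegral.continuousOn_primitive_interval
      (by rw [uIcc_of_le hT, integrableOn_Icc_iff_integrableOn_Ioc]; exact (hint T hT le_rfl).1)
      |>.mono (by rw [uIcc_of_le hT])
  have key := le_gronwallBound_of_liminf_deriv_right_le (δ := 0) (K := K) (ε := K * b) hcont
    (fun x hx y hy => (hderiv x hx).liminf_right_slope_le hy) (by simp)
    (fun x hx => (hw x hx.1 hx.2.le).trans_eq (by ring)) t ⟨ht, htT⟩
  rw [gronwallBound_of_K_ne_0 hK.ne'] at key
  simp only [sub_zero, zero_mul, zero_add, mul_div_cancel_left₀ _ hK.ne'] at key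
  calc w t ≤ K * (b + ∫ s in (0 : ℝ)..t, w s) := hw t ht htT
    _ ≤ K * (b + b * (Real.exp (K * t) - 1)) := by gcongr
    _ = _ := by ring

namespace Network

variable {m n : ℕ} {N : Network m n} {P : N.Priority} {r : ℝ}

theorem classSum_natCast (f : N.Edge → ℕ) (i : Fin (m + 1)) :
    ((N.classSum f i : ℕ) : ℝ) = N.classSum (fun e => (f e : ℝ)) i :=
  Nat.cast_sum _ _

theorem poolSum_natCast (f : N.Edge → ℕ) (j : Fin (n + 1)) :
    ((N.poolSum f j : ℕ) : ℝ) = N.poolSum (fun e => (f e : ℝ)) j :=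
  Nat.cast_sum _ _

theorem abs_sum_le_card_mul (s : Finset N.Edge) {f : N.Edge → ℝ} {b : ℝ} (hb : 0 ≤ b)
    (h : ∀ e, |f e| ≤ b) : |∑ e ∈ s, f e| ≤ Fintype.card N.Edge * b := by
  refine (Finset.abs_sum_le_sum_abs _ _).trans ?_
  refine (Finset.sum_le_card_nsmul _ _ b fun e _ => h e).trans ?_
  rw [nsmul_eq_mul]
  exact mul_le_mul_of_nonneg_right (by exact_mod_cast s.card_le_univ) hb

theorem abs_servers_sub_le (hr : 0 < r) (j : Fin (n + 1)) :
    (N.servers r j : ℝ) ≤ N.beta j * r ∧ N.beta j * r < N.servers r j + 1 :=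
  ⟨Nat.floor_le (mul_pos (N.beta_pos j) hr).le, Nat.lt_floor_add_one _⟩

namespace Realization

variable (R : Realization P r)

/-- The scaled deviation from the equilibrium, relative to a reference path `f`. -/
noncomputable def gap (h : ℝ) (f : ℝ → N.Vec) (t : ℝ) : N.Vec := h⁻¹ • R.deviation t - f t

variable {h : ℝ} {f : ℝ → N.Vec}

theorem psiPart_gap (t : ℝ) (e : N.Edge) : psiPart (R.gap h f t) e =
    h⁻¹ * ((R.state t).psi e - r * P.psiStar e) - psiPart (f t) e := rfl

theorem qPart_gap (t : ℝ) (i : Fin (m + 1)) :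
    qPart (R.gap h f t) i = h⁻¹ * (R.state t).q i - qPart (f t) i := rfl

theorem classSum_gap (t : ℝ) (i : Fin (m + 1)) : N.classSum (psiPart (R.gap h f t)) i =
    h⁻¹ * ((N.classSum (R.state t).psi i : ℕ) - r * N.classSum P.psiStar i) -
      N.classSum (psiPart (f t)) i := by
  rw [classSum_natCast]
  simp only [classSum, psiPart_gap, Finset.sum_sub_distrib, ← Finset.mul_sum]

theorem poolSum_gap (t : ℝ) (j : Fin (n + 1)) : N.poolSum (psiPart (R.gap h f t)) j =
    h⁻¹ * ((N.poolSum (R.state t).psi j : ℕ) - r * N.poolSum P.psiStar j) -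
      N.poolSum (psiPart (f t)) j := by
  rw [poolSum_natCast]
  simp only [poolSum, psiPart_gap, Finset.sum_sub_distrib, ← Finset.mul_sum]

theorem intervalIntegrable_norm_gap (hf : N.IsFluidSolution f) {t : ℝ} (ht : 0 ≤ t) :
    IntervalIntegrable (fun u => ‖R.gap h f u‖) MeasureTheory.volume 0 t := by
  refine IntervalIntegrable.norm (IntervalIntegrable.sub ?_ ?_)
  · exact R.intervalIntegrable_comp (fun s => h⁻¹ • (WithLp.toLp 2 (Sum.elim
      (fun e => (s.psi e : ℝ) - r * P.psiStar e) (fun i => (s.q i : ℝ))) : N.Vec)) ht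
  · exact (hf.continuous.mono
      (by rw [uIcc_of_le ht]; exact Icc_subset_Ici_self)).intervalIntegrable

theorem continuousWithinAt_norm_gap (hf : N.IsFluidSolution f) {t : ℝ} (ht : 0 ≤ t) :
    ContinuousWithinAt (fun u => ‖R.gap h f u‖) (Ioi t) t := by
  refine ContinuousWithinAt.norm (ContinuousWithinAt.sub ?_ ?_)
  · refine (continuousWithinAt_const (b := h⁻¹ • R.deviation t)).congr_of_eventuallyEq ?_ rfl
    filter_upwards [R.right t ht] with u hu
    simp only [deviation, hu]
  · exact (hf.continuous t ht).mono (Ioi_subset_Ici_self.trans (Ici_subset_Ici.2 ht))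

theorem abs_psi_sub_le (hh : 0 < h) (t : ℝ) (e : N.Edge) :
    |((R.state t).psi e : ℝ) - r * P.psiStar e| ≤ h * (‖R.gap h f t‖ + ‖f t‖) := by
  have h₁ := abs_psiPart_le_norm (R.gap h f t) e
  have h₂ := abs_psiPart_le_norm (f t) e
  have h₃ : ((R.state t).psi e : ℝ) - r * P.psiStar e =
      h * (psiPart (R.gap h f t) e + psiPart (f t) e) := by
    rw [psiPart_gap]
    field_simp
    ring
  rw [h₃, abs_mul, abs_of_pos hh]
  exact mul_le_mul_of_nonneg_left ((abs_add_le _ _).trans (add_le_add h₁ h₂)) hh.le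

/-- The class totals of the gap satisfy the integral equation of the local fluid model up to
errors. -/
theorem classSum_gap_eq (hbal : ∀ i, N.classSum (fun e => N.muE e * P.psiStar e) i = N.lam i)
    (hr : 0 < r) (hf : N.IsFluidSolution f) {t : ℝ} (ht : 0 ≤ t) (i : Fin (m + 1)) :
    N.classSum (psiPart (R.gap h f t)) i = N.classSum (psiPart (R.gap h f 0)) i +
      h⁻¹ * ((R.state 0).q i - (R.state t).q i) + h⁻¹ * (R.A i t - N.lam i * r * t) -
      h⁻¹ * N.classSum (fun e => (R.D e t : ℝ) -
        N.muE e * ∫ s in (0 : ℝ)..t, ((R.state s).psi e : ℝ)) i -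
      N.classSum (fun e => N.muE e * ∫ s in (0 : ℝ)..t, psiPart (R.gap h f s) e) i := by
  have hb := congrArg (Nat.cast (R := ℝ)) (R.class_balance hr ht i)
  push_cast at hb
  rw [classSum_natCast (fun e => R.D e t)] at hb
  have hint : ∀ e, ∫ s in (0 : ℝ)..t, psiPart (R.gap h f s) e =
      h⁻¹ * ((∫ s in (0 : ℝ)..t, ((R.state s).psi e : ℝ)) - t * (r * P.psiStar e)) -
        ∫ s in (0 : ℝ)..t, psiPart (f s) e := by
    intro e
    simp only [psiPart_gap]
    have hfi : IntervalIntegrable (fun s => psiPart (f s) e) MeasureTheory.volume 0 t := by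
      simpa using hf.intervalIntegrable e 1 ht
    rw [intervalIntegral.integral_sub (((R.intervalIntegrable_zero e ht).sub
      intervalIntegrable_const).const_mul _) hfi, intervalIntegral.integral_const_mul,
      intervalIntegral.integral_sub (R.intervalIntegrable_zero e ht) intervalIntegrable_const,
      intervalIntegral.integral_const, smul_eq_mul, sub_zero]
  have hdyn := hf.dynamics t ht i
  simp only [intervalIntegral.integral_const_mul] at hdyn
  have h₁ : N.classSum (fun e => N.muE e * ∫ s in (0 : ℝ)..t, psiPart (R.gap h f s) e) i =
      h⁻¹ * (N.classSum (fun e => N.muE e * ∫ s in (0 : ℝ)..t, ((R.state s).psi e : ℝ)) i -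
        t * r * N.lam i) - N.classSum (fun e => N.muE e * ∫ s in (0 : ℝ)..t, psiPart (f s) e) i := by
    rw [← hbal]
    simp only [classSum, Finset.mul_sum, ← Finset.sum_sub_distrib]
    refine Finset.sum_congr rfl fun e _ => ?_
    rw [hint]
    ring
  have h₂ : N.classSum (fun e => (R.D e t : ℝ) -
      N.muE e * ∫ s in (0 : ℝ)..t, ((R.state s).psi e : ℝ)) i =
      N.classSum (fun e => (R.D e t : ℝ)) i -
        N.classSum (fun e => N.muE e * ∫ s in (0 : ℝ)..t, ((R.state s).psi e : ℝ)) i :=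
    Finset.sum_sub_distrib _ _
  rw [h₁, h₂, classSum_gap, classSum_gap, hdyn]
  linear_combination h⁻¹ * hb

end Realization

/-- As long as the collapse estimates hold, the gap satisfies an integral inequality. -/
theorem Priority.exists_gap_le_integral (P : N.Priority)
    (hbal : ∀ i, N.classSum (fun e => N.muE e * P.psiStar e) i = N.lam i)
    (hfull : ∀ j, j ≠ Fin.last n → N.poolSum P.psiStar j = N.beta j) {Kc : ℝ} (hKc : 0 ≤ Kc) :
    ∃ K : ℝ, 1 ≤ K ∧ ∀ (r h η t : ℝ) (R : Realization P r) (f : ℝ → N.Vec), 0 < r → 0 < h →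
      1 ≤ η * h → N.IsFluidSolution f → 0 ≤ t →
      (∀ i, |(R.A i t : ℝ) - N.lam i * r * t| ≤ η * h) →
      (∀ e, |(R.D e t : ℝ) - N.muE e * ∫ s in (0 : ℝ)..t, ((R.state s).psi e : ℝ)| ≤ η * h) →
      ‖R.gap h f 0‖ ≤ η → (∀ i, ((R.state 0).q i : ℝ) ≤ Kc * (η * h)) →
      (∀ i, ((R.state t).q i : ℝ) ≤ Kc * (η * h)) →
      (∀ j, j ≠ Fin.last n → ((R.state t).idle r j : ℝ) ≤ Kc * (η * h)) →
      ‖R.gap h f t‖ ≤ K * (η + ∫ s in (0 : ℝ)..t, ‖R.gap h f s‖) := by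
  obtain ⟨K₀, hK₀, hbound⟩ := exists_norm_le_of_totals P
  have hμ : 0 ≤ ∑ e : N.Edge, N.muE e := Finset.sum_nonneg fun e _ => (muE_pos e).le
  -- For a class total, the initial gap and the departures cost `card` each, the queues `Kc`, the
  -- arrivals `1`; a pool total costs `Kc + 1`, the `1` covering the rounding of server numbers. The
  -- outer `+ 1` secures `1 ≤ K`.
  refine ⟨K₀ * (2 * Fintype.card N.Edge + Kc + 1 + ∑ e : N.Edge, N.muE e) + 1, ?_,
    fun r h η t R f hr hh hηh hf ht hA hD h0 hq0 hq hidle => ?_⟩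
  · have : 0 ≤ K₀ * (2 * Fintype.card N.Edge + Kc + 1 + ∑ e : N.Edge, N.muE e) := by positivity
    linarith
  have hη : 0 ≤ η := (norm_nonneg _).trans h0
  have hI : 0 ≤ ∫ s in (0 : ℝ)..t, ‖R.gap h f s‖ :=
    intervalIntegral.integral_nonneg ht fun u _ => norm_nonneg _
  set I := ∫ s in (0 : ℝ)..t, ‖R.gap h f s‖ with hIdef
  have hscale : ∀ {x c : ℝ}, |x| ≤ c * (η * h) → |h⁻¹ * x| ≤ c * η := fun {x c} hx => by
    rw [abs_mul, abs_of_pos (inv_pos.2 hh), inv_mul_le_iff₀ hh]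
    linarith
  have hcard : (0 : ℝ) ≤ Fintype.card N.Edge := Nat.cast_nonneg _
  have hmain : ‖R.gap h f t‖ ≤
      K₀ * ((2 * Fintype.card N.Edge + Kc + 1) * η + (∑ e : N.Edge, N.muE e) * I) := by
    have hμI : 0 ≤ (∑ e : N.Edge, N.muE e) * I := mul_nonneg hμ hI
    have hcη : 0 ≤ Fintype.card N.Edge * η := mul_nonneg hcard hη
    refine hbound _ _ (fun i => ?_) (fun j hj => ?_) fun i => ?_
    · rw [R.classSum_gap_eq hbal hr hf ht]
      have e₁ : |N.classSum (psiPart (R.gap h f 0)) i| ≤ Fintype.card N.Edge * η :=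
        abs_sum_le_card_mul _ hη fun e => (abs_psiPart_le_norm _ _).trans h0
      have e₂ : |h⁻¹ * (((R.state 0).q i : ℝ) - (R.state t).q i)| ≤ Kc * η := hscale <| by
        have p₁ : (0 : ℝ) ≤ (R.state 0).q i := Nat.cast_nonneg _
        have p₂ : (0 : ℝ) ≤ (R.state t).q i := Nat.cast_nonneg _
        rw [abs_le]
        constructor <;> linarith [hq0 i, hq i]
      have e₃ : |h⁻¹ * ((R.A i t : ℝ) - N.lam i * r * t)| ≤ 1 * η :=
        hscale ((hA i).trans_eq (one_mul _).symm)
      have e₄ : |h⁻¹ * N.classSum (fun e => (R.D e t : ℝ) -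
          N.muE e * ∫ s in (0 : ℝ)..t, ((R.state s).psi e : ℝ)) i| ≤
          Fintype.card N.Edge * η :=
        hscale (abs_sum_le_card_mul _ (zero_le_one.trans hηh) hD)
      have e₅ : |N.classSum (fun e => N.muE e *
          ∫ s in (0 : ℝ)..t, psiPart (R.gap h f s) e) i| ≤ (∑ e : N.Edge, N.muE e) * I := by
        have hterm : ∀ e : N.Edge, |N.muE e * ∫ s in (0 : ℝ)..t, psiPart (R.gap h f s) e| ≤
            N.muE e * I := fun e => by
          rw [abs_mul, abs_of_pos (muE_pos e)]
          refine mul_le_mul_of_nonneg_left ?_ (muE_pos e).le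
          exact intervalIntegral.norm_integral_le_of_norm_le
            (f := fun s => psiPart (R.gap h f s) e) ht
            (Eventually.of_forall fun s _ => abs_psiPart_le_norm _ e)
            (R.intervalIntegrable_norm_gap hf ht)
        refine (Finset.abs_sum_le_sum_abs _ _).trans ?_
        refine (Finset.sum_le_sum fun e _ => hterm e).trans ?_
        rw [Finset.sum_mul]
        exact Finset.sum_le_univ_sum_of_nonneg fun e => mul_nonneg (muE_pos e).le hI
      rw [abs_le] at *
      constructor <;> linarith
    · rw [R.poolSum_gap, hfull j hj, hf.pools t ht j (lt_of_le_of_ne (Fin.le_last _) hj), sub_zero]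
      have e₁ : |h⁻¹ * (((N.poolSum (R.state t).psi j : ℕ) : ℝ) - r * N.beta j)| ≤ (Kc + 1) * η :=
        hscale <| by
          have p₁ := (R.admissible hr ht).idle_eq j
          have p₂ : (0 : ℝ) ≤ (R.state t).idle r j := Nat.cast_nonneg _
          have p₃ := abs_servers_sub_le (N := N) hr j
          have p₄ := hidle j hj
          have p₅ := mul_nonneg hKc (zero_le_one.trans hηh)
          rw [abs_le]
          constructor <;> linarith
      linarith
    · rw [R.qPart_gap, hf.queues t ht, sub_zero]
      have e₁ : |h⁻¹ * ((R.state t).q i : ℝ)| ≤ Kc * η := hscale <| by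
        rw [abs_of_nonneg (Nat.cast_nonneg _)]
        exact hq i
      linarith
  have hC : 0 ≤ 2 * Fintype.card N.Edge + Kc + 1 := by positivity
  calc ‖R.gap h f t‖ ≤ _ := hmain
    _ ≤ _ := by
      have p₁ := mul_nonneg hμ hη
      have p₂ := mul_nonneg hC hI
      have p₃ := mul_nonneg hK₀.le (add_nonneg p₁ p₂)
      linarith

/-- Uniform tracking: realizations whose driving processes are close to their means, started close
to a local fluid model, remain close to it. -/
theorem Priority.exists_tracking (P : N.Priority) (hN : N.AllActivitiesEssential) :
    ∃ δ r₀ K : ℝ, 0 < δ ∧ 0 < r₀ ∧ 0 < K ∧ ∀ (r h η T M : ℝ) (R : Realization P r)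
      (f : ℝ → N.Vec), r₀ ≤ r → 0 < h → 1 ≤ η * h → N.IsFluidSolution f →
      (∀ i t, 0 ≤ t → t ≤ T → |(R.A i t : ℝ) - N.lam i * r * t| ≤ η * h) →
      (∀ e t, 0 ≤ t → t ≤ T →
        |(R.D e t : ℝ) - N.muE e * ∫ s in (0 : ℝ)..t, ((R.state s).psi e : ℝ)| ≤ η * h) →
      ‖R.gap h f 0‖ ≤ η → (∀ t, 0 ≤ t → t ≤ T → ‖f t‖ ≤ M) → h * (1 + M) ≤ δ * r →
      K * η * Real.exp (K * T) ≤ 1 →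
      ∀ t, 0 ≤ t → t ≤ T → ‖R.gap h f t‖ ≤ K * η * Real.exp (K * T) := by
  obtain ⟨hpos, hbal, hfull, hlast⟩ := P.psiStar_spec hN
  have hκ' : ∀ᶠ κ : ℝ in 𝓝[>] 0, ∀ e, κ < N.muE e * P.psiStar e := by
    rw [eventually_all]
    exact fun e => (tendsto_id.mono_left nhdsWithin_le_nhds).eventually_lt_const
      (mul_pos (muE_pos e) (hpos e))
  obtain ⟨κ, hκ, hκ0⟩ := (hκ'.and self_mem_nhdsWithin).exists
  replace hκ0 : 0 < κ := hκ0
  set σ := N.beta (Fin.last n) - N.poolSum P.psiStar (Fin.last n) with hσdef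
  have hσ : 0 < σ := sub_pos.2 hlast
  -- `δ` must be small enough for the drift error to stay below `κ` and for pool J not to fill up.
  -- Both are required with `2 * δ`, which leaves room for one jump beyond `δ * r`.
  have hsmall : ∀ c b : ℝ, 0 < b → ∀ᶠ δ : ℝ in 𝓝[>] 0, 2 * δ * c < b := fun c b hb => by
    have : Continuous fun δ : ℝ => 2 * δ * c := by fun_prop
    have := (this.tendsto 0).mono_left (nhdsWithin_le_nhds (s := Ioi 0))
    simp only [mul_zero, zero_mul] at this
    exact this.eventually_lt_const hb
  obtain ⟨δ, ⟨hδμ, hδσ⟩, hδ0⟩ := (((hsmall (∑ e : N.Edge, N.muE e) κ hκ0).and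
    (hsmall (Fintype.card N.Edge) (σ / 2) (half_pos hσ))).and self_mem_nhdsWithin).exists
  replace hδ0 : 0 < δ := hδ0
  obtain ⟨Kc, hKc0, hKc⟩ := exists_collapse hbal hκ0.le (fun e => (hκ e).le) hδμ.le
  have hcard : (0 : ℝ) ≤ Fintype.card N.Edge := Nat.cast_nonneg _
  have hKc1 : 0 ≤ (Kc + 1) * (Fintype.card N.Edge + 1) := by positivity
  obtain ⟨K, hK1, hK⟩ := P.exists_gap_le_integral hbal hfull hKc1
  have hK0 : 0 < K := zero_lt_one.trans_le hK1
  -- `2 ≤ r * σ` makes the slack of pool J outweigh the rounding of its size; `1 ≤ r * δ` makes `δ *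
  -- r` outweigh a unit jump.
  refine ⟨δ, max (2 / σ) (1 / δ), K, hδ0, lt_max_of_lt_right (by positivity), hK0,
    fun r h η T M R f hr hh hηh hf hA hD h0 hM hhr hsm => ?_⟩
  have hrσ : 2 ≤ r * σ := (div_le_iff₀ hσ).1 ((le_max_left _ _).trans hr)
  have hrδ : 1 ≤ r * δ := (div_le_iff₀ hδ0).1 ((le_max_right _ _).trans hr)
  have hr0 : 0 < r := (lt_max_of_lt_right (by positivity : 0 < 1 / δ)).trans_le hr
  have hη : 0 ≤ η := (norm_nonneg _).trans h0
  have hηh0 : 0 ≤ η * h := zero_le_one.trans hηh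
  have hnear1 : ∀ t, 0 ≤ t → t ≤ T → ‖R.gap h f t‖ ≤ 1 → ∀ e,
      |((R.state t).psi e : ℝ) - r * P.psiStar e| ≤ δ * r := fun t ht htT hg e =>
    (R.abs_psi_sub_le (f := f) hh t e).trans <|
      (mul_le_mul_of_nonneg_left (add_le_add hg (hM t ht htT)) hh.le).trans hhr
  have hηa : η * h ≤ (Fintype.card N.Edge + 1) * (η * h) :=
    le_mul_of_one_le_left hηh0 (by linarith)
  have core : ∀ t, 0 ≤ t → t ≤ T →
      (∀ e u, 0 ≤ u → u ≤ t → |((R.state u).psi e : ℝ) - r * P.psiStar e| ≤ 2 * δ * r) →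
      ‖R.gap h f t‖ ≤ K * η * Real.exp (K * T) := by
    intro t ht htT hnear
    -- The error is multiplied by `card + 1` because the initial idleness of a pool is a sum of up
    -- to `card` deviations.
    have htame : R.Tame (2 * δ) ((Fintype.card N.Edge + 1) * (η * h)) t := by
      refine ⟨fun i u hu hut => (hA i u hu (hut.trans htT)).trans hηa,
        fun e u hu hut => (hD e u hu (hut.trans htT)).trans hηa, hnear, fun u hu hut => ?_,
        hηh.trans hηa, fun i => ?_, fun j hj => ?_⟩
      · have p₁ : |∑ e : N.Edge with e.1.2 = Fin.last n,
            (((R.state u).psi e : ℝ) - r * P.psiStar e)| ≤ Fintype.card N.Edge * (2 * δ * r) :=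
          abs_sum_le_card_mul _ (by positivity) fun e => hnear e u hu hut
        rw [Finset.sum_sub_distrib, ← Finset.mul_sum] at p₁
        change |N.poolSum (fun e => ((R.state u).psi e : ℝ)) (Fin.last n) -
          r * N.poolSum P.psiStar (Fin.last n)| ≤ _ at p₁
        rw [← poolSum_natCast] at p₁
        have p₂ := (abs_le.1 p₁).2
        have p₃ := (abs_servers_sub_le (N := N) hr0 (Fin.last n)).2
        have p₄ := mul_lt_mul_of_pos_right hδσ hr0
        have : ((N.poolSum (R.state u).psi (Fin.last n) : ℕ) : ℝ) < N.servers r (Fin.last n) := by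
          have p₅ : N.beta (Fin.last n) = N.poolSum P.psiStar (Fin.last n) + σ := by
            rw [hσdef]; ring
          rw [p₅] at p₃
          linarith
        exact_mod_cast this
      · have p₁ := (abs_le.1 ((abs_qPart_le_norm _ i).trans h0)).2
        rw [R.qPart_gap, hf.queues 0 le_rfl, sub_zero, inv_mul_le_iff₀ hh] at p₁
        linarith
      · have p₁ : |N.poolSum (psiPart (R.gap h f 0)) j| ≤ Fintype.card N.Edge * η :=
          abs_sum_le_card_mul _ hη fun e => (abs_psiPart_le_norm _ _).trans h0
        rw [R.poolSum_gap, hfull j hj, hf.pools 0 le_rfl j (lt_of_le_of_ne (Fin.le_last _) hj),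
          sub_zero, abs_mul, abs_of_pos (inv_pos.2 hh), inv_mul_le_iff₀ hh] at p₁
        have p₂ := (abs_le.1 p₁).1
        have p₃ := (abs_servers_sub_le (N := N) hr0 j).1
        rw [R.initial.idle_eq]
        linarith
    have hcoll := hKc r R _ t hr0 htame
    have hKle : Kc * ((Fintype.card N.Edge + 1) * (η * h)) ≤
        (Kc + 1) * (Fintype.card N.Edge + 1) * (η * h) := by
      have : 0 ≤ (Fintype.card N.Edge + 1) * (η * h) := by positivity
      linarith
    have hgr := le_mul_exp_of_le_integral (w := fun u => ‖R.gap h f u‖) (b := η) (T := t) hK0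
      (fun u hu _ => R.intervalIntegrable_norm_gap hf hu)
      (fun u hu _ => R.continuousWithinAt_norm_gap hf hu)
      (fun u hu hut => hK r h η u R f hr0 hh hηh hf hu (fun i => hA i u hu (hut.trans htT))
        (fun e => hD e u hu (hut.trans htT)) h0
        (fun i => ((hcoll 0 le_rfl ht).1 i).trans hKle)
        (fun i => ((hcoll u hu hut).1 i).trans hKle)
        (fun j hj => ((hcoll u hu hut).2 j hj).trans hKle)) ht le_rfl
    refine hgr.trans (mul_le_mul_of_nonneg_left ?_ (by positivity))
    exact Real.exp_le_exp.2 (mul_le_mul_of_nonneg_left htT hK0.le)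
  have hδ2 : δ * r ≤ 2 * δ * r := by nlinarith
  have hall : ∀ t, 0 ≤ t → (t ≤ T → ∀ e,
      |((R.state t).psi e : ℝ) - r * P.psiStar e| ≤ δ * r) := by
    -- The loop closes because `core` assumes only the bound `2 * δ * r` up to `t`, while its
    -- conclusion, by `hnear1`, yields the stronger bound `δ * r` at `t`.
    intro t ht
    refine continuous_induction (p := fun t => t ≤ T → ∀ e,
      |((R.state t).psi e : ℝ) - r * P.psiStar e| ≤ δ * r) (fun hT => ?_) (fun t ht h => ?_)
      (fun t ht h htT => ?_) ht
    · refine hnear1 0 le_rfl hT (h0.trans (le_trans ?_ hsm))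
      have p₁ : 1 ≤ Real.exp (K * T) := Real.one_le_exp (mul_nonneg hK0.le hT)
      have p₂ : 1 ≤ K * Real.exp (K * T) := one_le_mul_of_one_le_of_one_le hK1 p₁
      nlinarith
    · filter_upwards [R.right t ht, self_mem_nhdsWithin] with u hu htu huT
      rw [hu]
      exact h ((le_of_lt htu).trans huT)
    · refine hnear1 t ht.le htT ((core t ht.le htT fun e u hu hut => ?_).trans hsm)
      -- At the endpoint an event may have moved an occupancy by one, which `1 ≤ r * δ` keeps within
      -- `2 * δ * r`.
      rcases hut.lt_or_eq with hlt | rfl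
      · exact (h u hu hlt (hlt.le.trans htT) e).trans hδ2
      · obtain ⟨da, dd, hev⟩ := R.exists_step_left ht
        obtain ⟨v, hv, hvu⟩ := (hev.and (Ioo_mem_nhdsLT ht)).exists
        have p₁ := abs_le.1 (h v hvu.1.le hvu.2 (hvu.2.le.trans htT) e)
        obtain ⟨p₂, p₃⟩ := hv.1.psi_le e
        have p₂' : ((R.state u).psi e : ℝ) ≤ (R.state v).psi e + 1 := by exact_mod_cast p₂
        have p₃' : ((R.state v).psi e : ℝ) ≤ (R.state u).psi e + 1 := by exact_mod_cast p₃
        rw [abs_le]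
        constructor <;> linarith
  exact fun t ht htT => core t ht htT fun e u hu hut => (hall u hu (hut.trans htT) e).trans hδ2

end Network

/-! ### Passage to the limit. -/

namespace Network

variable {m n : ℕ} {N : Network m n}

theorem uoc_gap (P : N.Priority) (hN : N.AllActivitiesEssential) {r h : ℕ → ℝ}
    (R : ∀ k, Realization P (r k)) {f : ℝ → N.Vec} (hr : Tendsto r atTop atTop)
    (hh : Tendsto h atTop atTop) (hhr : Tendsto (fun k => h k / r k) atTop (𝓝 0))
    (hA : ∀ i, UOC (fun k t => (h k)⁻¹ * (((R k).A i t : ℝ) - N.lam i * r k * t)) (fun _ => 0))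
    (hD : ∀ e, UOC (fun k t => (h k)⁻¹ * (((R k).D e t : ℝ) -
      N.muE e * ∫ s in (0 : ℝ)..t, (((R k).state s).psi e : ℝ))) (fun _ => 0))
    (h0 : Tendsto (fun k => (h k)⁻¹ • (R k).deviation 0) atTop (𝓝 (f 0)))
    (hf : N.IsFluidSolution f) :
    UOC (fun k t => (h k)⁻¹ • (R k).deviation t) f := by
  intro T
  obtain ⟨δ, r₀, K, hδ, -, hK, htrack⟩ := P.exists_tracking hN
  obtain ⟨M, hM⟩ := isCompact_Icc.exists_bound_of_continuousOn
    (hf.continuous.mono (Icc_subset_Ici_self : Icc 0 T ⊆ Ici 0))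
  rw [Metric.tendstoUniformlyOn_iff]
  intro ε hε
  -- Chosen so that the tracking bound equals `min 1 (ε / 2)`: the `1` is required for tracking, the
  -- `ε / 2` for convergence.
  set η := min 1 (ε / 2) / (K * Real.exp (K * T)) with hηdef
  have hKe : 0 < K * Real.exp (K * T) := mul_pos hK (Real.exp_pos _)
  have hη : 0 < η := div_pos (lt_min one_pos (half_pos hε)) hKe
  have hηK : K * η * Real.exp (K * T) = min 1 (ε / 2) := by
    rw [hηdef]
    field_simp
  have hbound : ∀ {g : ℕ → ℝ → ℝ}, UOC (fun k t => (h k)⁻¹ * g k t) (fun _ => 0) →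
      ∀ᶠ k in atTop, 0 < h k → ∀ t, 0 ≤ t → t ≤ T → |g k t| ≤ η * h k := by
    intro g hg
    filter_upwards [Metric.tendstoUniformlyOn_iff.1 (hg T) η hη] with k hk hpos t ht htT
    have := hk t ⟨ht, htT⟩
    rw [dist_zero_left, norm_mul, Real.norm_eq_abs, Real.norm_eq_abs, abs_of_pos (inv_pos.2 hpos),
      inv_mul_lt_iff₀ hpos] at this
    linarith
  have hlim : Tendsto (fun k => h k / r k * (1 + M)) atTop (𝓝 0) := by
    simpa using hhr.mul_const (1 + M)
  have h0' := (tendsto_iff_norm_sub_tendsto_zero.1 h0).eventually_le_const hη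
  filter_upwards [hr.eventually_ge_atTop r₀, hr.eventually_gt_atTop 0, hh.eventually_gt_atTop 0,
    hh.eventually_ge_atTop (1 / η), eventually_all.2 fun i => hbound (hA i),
    eventually_all.2 fun e => hbound (hD e), h0', hlim.eventually_le_const hδ]
    with k hk₁ hk₂ hk₃ hk₄ hk₅ hk₆ hk₇ hk₈ t ht
  have hkey := htrack (r k) (h k) η T M (R k) f hk₁ hk₃ ((div_le_iff₀' hη).1 hk₄) hf
    (fun i => hk₅ i hk₃) (fun e => hk₆ e hk₃) hk₇ (fun t ht htT => hM t ⟨ht, htT⟩)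
    (by rwa [div_mul_eq_mul_div, div_le_iff₀ hk₂] at hk₈) (hηK.trans_le (min_le_left _ _))
    t ht.1 ht.2
  rw [dist_comm, dist_eq_norm]
  calc _ ≤ _ := hkey
    _ = min 1 (ε / 2) := hηK
    _ ≤ ε / 2 := min_le_right _ _
    _ < ε := half_lt_self hε

/-- The difference of two solutions is a solution, so the decay estimate bounds it by its initial
value for all times at once. -/
theorem IsFluidSolution.uoc_of_tendsto (P : N.Priority) {g : ℕ → ℝ → N.Vec} {f : ℝ → N.Vec}
    (hg : ∀ k, N.IsFluidSolution (g k)) (hf : N.IsFluidSolution f)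
    (h : Tendsto (fun k => g k 0) atTop (𝓝 (f 0))) : UOC g f := by
  obtain ⟨c₁, c₂, hc₁, hc₂, hdecay⟩ := exists_decay P
  intro T
  rw [Metric.tendstoUniformlyOn_iff]
  intro ε hε
  filter_upwards [(tendsto_iff_norm_sub_tendsto_zero.1 h).eventually_lt_const (div_pos hε hc₁)]
    with k hk t ht
  rw [dist_comm, dist_eq_norm]
  have hexp : Real.exp (-c₂ * t) ≤ 1 := by
    rw [Real.exp_le_one_iff, neg_mul, neg_nonpos]
    exact mul_nonneg hc₂.le ht.1
  calc ‖g k t - f t‖ ≤ ‖g k 0 - f 0‖ * (c₁ * Real.exp (-c₂ * t)) :=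
        hdecay _ ((hg k).sub hf) t ht.1
    _ ≤ ‖g k 0 - f 0‖ * c₁ :=
        mul_le_mul_of_nonneg_left (mul_le_of_le_one_right hc₁.le hexp) (norm_nonneg _)
    _ < ε := (lt_div_iff₀ hc₁).1 hk

end Network

theorem theorem5 {m n : ℕ} (N : Network m n) (P : N.Priority) (hN : N.AllActivitiesEssential) :
    -- subsequential convergence to local fluid models
    (∀ (ε : ℝ) (r h : ℕ → ℝ) (R : ∀ k, Network.Realization P (r k)) (f₀ : N.Vec),
      0 < ε → ε < 1 / 2 →
      (∀ k, 0 < r k) → Tendsto r atTop atTop →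
      (∀ k, (r k) ^ (1 / 2 + ε) ≤ h k) → Tendsto (fun k => h k / r k) atTop (𝓝 0) →
      (∀ i, UOC (fun k t => (h k)⁻¹ * (((R k).A i t : ℝ) - N.lam i * r k * t)) (fun _ => 0)) →
      (∀ e, UOC (fun k t => (h k)⁻¹ * (((R k).D e t : ℝ) -
        N.muE e * ∫ s in (0 : ℝ)..t, (((R k).state s).psi e : ℝ))) (fun _ => 0)) →
      Tendsto (fun k => (h k)⁻¹ • (R k).deviation 0) atTop (𝓝 f₀) →
      (∀ i, Network.qPart f₀ i = 0) →
      (∀ j, j < Fin.last n → N.poolSum (Network.psiPart f₀) j = 0) →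
      ∀ φ : ℕ → ℕ, StrictMono φ → ∃ φ' : ℕ → ℕ, StrictMono φ' ∧ ∃ f : ℝ → N.Vec,
        UOC (fun k t => (h (φ (φ' k)))⁻¹ • (R (φ (φ' k))).deviation t) f ∧
        f 0 = f₀ ∧ N.IsLocalFluidModel f) ∧
    -- continuous dependence on the initial state
    (∀ (g : ℕ → ℝ → N.Vec) (f : ℝ → N.Vec),
      (∀ k, N.IsLocalFluidModel (g k)) → N.IsLocalFluidModel f →
      Tendsto (fun k => g k 0) atTop (𝓝 (f 0)) → UOC g f) ∧
    -- uniform exponential decay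
    (∃ c₁ c₂ : ℝ, 0 < c₁ ∧ 0 < c₂ ∧ ∀ f : ℝ → N.Vec, N.IsLocalFluidModel f →
      ∀ t, 0 ≤ t → ‖f t‖ ≤ ‖f 0‖ * (c₁ * Real.exp (-c₂ * t))) := by
  refine ⟨?_, fun g f hg hf h => Network.IsFluidSolution.uoc_of_tendsto P
    (fun k => (hg k).isFluidSolution) hf.isFluidSolution h, ?_⟩
  · intro ε r h R f₀ hε _ _ hr hrh hhr hA hD h0 hq hp φ hφ
    -- The limit is constructed from `f₀` beforehand and the whole sequence converges to it, so the
    -- given subsequence needs no thinning.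
    obtain ⟨f, rfl, hf⟩ := Network.exists_isLocalFluidModel P hq hp
    have hh : Tendsto h atTop atTop := tendsto_atTop_mono hrh
      ((tendsto_rpow_atTop (by positivity)).comp hr)
    exact ⟨id, strictMono_id, f, fun T s hs => hφ.tendsto_atTop.eventually
      (Network.uoc_gap P hN R hr hh hhr hA hD h0 hf.isFluidSolution T s hs), rfl, hf⟩
  · obtain ⟨c₁, c₂, hc₁, hc₂, hdecay⟩ := Network.exists_decay P
    exact ⟨c₁, c₂, hc₁, hc₂, fun f hf => hdecay f hf.isFluidSolution⟩
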